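/- Let $X$ be a set with at least two points. A quasi-metric on $X$ is a function $d:X\times X\to[0,\infty)$ such that $d(x,y)=0$ if and only if $x=y$, and for which there are constants $C_0,C_1\in(0,\infty)$ with $d(y,x)\le C_0\,d(x,y)$ and $d(x,y)\le C_1\max\{d(x,z),d(z,y)\}$ for all $x,y,z\in X$. Write $$C_d:=\sup\Big\{\tfrac{d(x,y)}{\max\{d(x,z),d(z,y)\}}:\ x,y,z\in X \text{ not all equal}\Big\}\in[1,\infty),\qquad B_d(x,r):=\{y\in X:\ d(x,y)<r\},$$ and let $\tau_d$ be the topology whose open sets are the sets $O\subseteq X$ such that every $x\in O$ has some $r>0$ with $B_d(x,r)\subseteq O$. Two quasi-metrics $d,\rho$ are equivalent, $\rho\approx d$, if $\kappa^{-1}\rho\le d\le\kappa\rho$ for some constant $\kappa>0$. Put $$\mathrm{ind}(X,d):=\sup_{\rho\approx d}(\log_2 C_\rho)^{-1}\in(0,\infty],\qquad 1/0:=\infty,$$ the supremum being over all quasi-metrics $\rho$ on $X$ equivalent to $d$. For $\alpha\in(0,\infty)$ and $q\in(0,\infty]$, write $\alpha\preceq_q\mathrm{ind}(X,d)$ if $\alpha\le\mathrm{ind}(X,d)$,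 where equality is permitted only if $q=\infty$ and the supremum defining $\mathrm{ind}(X,d)$ is attained. Let $(X,d,\mu)$ be a quasi-metric-measure space, that is, $d$ is a quasi-metric on $X$ and $\mu$ is a nonnegative measure on a $\sigma$-algebra that contains the Borel sets of $\tau_d$ and all the balls $B_d(x,r)$, with $0<\mu(B_d(x,r))<\infty$ for all $x\in X$ and $r\in(0,\infty)$. Let $\alpha,p\in(0,\infty)$ and $q\in(0,\infty]$. An $\alpha$-fractional gradient of a measurable $u:X\to\mathbb R$ is a sequence $\vec g=(g_k)_{k\in\mathbb Z}$ of nonnegative (possibly $+\infty$-valued) measurable functions on $X$ for which there is a measurable set $E$ with $\mu(E)=0$ and $$|u(x)-u(y)|\le d(x,y)^\alpha\,(g_k(x)+g_k(y))$$ for all $k\in\mathbb Z$ and $x,y\in X\setminus E$ with $2^{-k-1}\le d(x,y)<2^{-k}$. Let $\|u\|_{\dot M^\alpha_{p,q}}$ and $\|u\|_{\dot N^\alpha_{p,q}}$ be the infima over all $\alpha$-fractional gradients $\vec g$ of $u$ of $\big\|\,\|(g_k)_k\|_{\ell^q(\mathbb Z)}\big\|_{L^p(X,\mu)}$ and of $\big\|(\|g_k\|_{L^p(X,\mu)})_k\big\|_{\ell^q(\mathbb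 Z)}$, respectively. The spaces $M^\alpha_{p,q}(X,d,\mu)$ and $N^\alpha_{p,q}(X,d,\mu)$ consist of the measurable $u\in L^p(X,\mu)$ for which the respective semi-norm is finite, with the (quasi-)norm $\|u\|_{L^p(X,\mu)}$ plus that semi-norm. The embedding of such a space into $L^p(X,\mu)$ is compact if every sequence bounded in the space has a subsequence that converges in $L^p(X,\mu)$. Theorem. Suppose that there is $\delta_0\in(0,\infty)$ such that for every $\delta\in(0,\delta_0]$ the measure $\mu$ is $(C_d,\delta)$-doubling, i.e. there is a constant $C(\delta)\in[1,\infty)$ with $\mu(B_d(x,C_d\delta))\le C(\delta)\,\mu(B_d(x,\delta))$ for all $x\in X$. Then the following statements are equivalent. 1. $(X,d)$ is totally bounded, i.e. for every $\varepsilon>0$ it is covered by finitely many balls $B_d(x,\varepsilon)$. 2. $\mu$ is integrable, i.e. there is a quasi-metric $\rho\approx d$ such that for every $r\in(0,\infty)$ all the balls $B_\rho(x,r)$ are measurable, the function $x\mapsto\mu(B_\rho(x,r))$ is measurable, and $\int_X\frac{1}{\mu(B_\rho(x,r))}\,d\mu(x)<\infty$. 3. For all $\alpha,p\in(0,\infty)$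 and $q\in(0,\infty]$ with $\alpha\preceq_q\mathrm{ind}(X,d)$, the embedding $M^\alpha_{p,q}(X,d,\mu)\hookrightarrow L^p(X,\mu)$ is compact. 4. For all $\alpha,p\in(0,\infty)$ and $q\in(0,\infty]$ with $\alpha\preceq_q\mathrm{ind}(X,d)$, the embedding $N^\alpha_{p,q}(X,d,\mu)\hookrightarrow L^p(X,\mu)$ is compact. 5. There exist $\alpha,p\in(0,\infty)$ and $q\in(0,\infty]$ with $\alpha\preceq_q\mathrm{ind}(X,d)$ such that the embedding $M^\alpha_{p,q}(X,d,\mu)\hookrightarrow L^p(X,\mu)$ is compact. 6. There exist $\alpha,p\in(0,\infty)$ and $q\in(0,\infty]$ with $\alpha\preceq_q\mathrm{ind}(X,d)$ such that the embedding $N^\alpha_{p,q}(X,d,\mu)\hookrightarrow L^p(X,\mu)$ is compact. -/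

import Mathlib

open MeasureTheory Filter Topology
open scoped ENNReal

noncomputable section

namespace QuasiMetric

/-- `d` is a quasi-metric on `X`. -/
structure IsQuasiMetric {X : Type*} (d : X → X → ℝ) : Prop where
  nonneg : ∀ x y, 0 ≤ d x y
  eq_zero_iff : ∀ x y, d x y = 0 ↔ x = y
  quasi_symm : ∃ C₀ : ℝ, 0 < C₀ ∧ ∀ x y, d y x ≤ C₀ * d x y
  quasi_triangle : ∃ C₁ : ℝ, 0 < C₁ ∧ ∀ x y z, d x y ≤ C₁ * max (d x z) (d z y)

/-- The ball `B_d(x, r) = {y : d(x, y) < r}`; the order of the arguments of `d` matters. -/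
def qball {X : Type*} (d : X → X → ℝ) (x : X) (r : ℝ) : Set X := {y | d x y < r}

/-- The optimal constant `C_d` in the quasi-ultrametric inequality. For a quasi-metric on a set
with at least two points this is a supremum of a nonempty bounded set, and it is at least `1`. -/
def optConst {X : Type*} (d : X → X → ℝ) : ℝ :=
  sSup {t : ℝ | ∃ x y z : X, ¬ (x = y ∧ y = z) ∧ t = d x y / max (d x z) (d z y)}

/-- Equivalence `d ≈ ρ` of quasi-metrics. -/
def Equivalent {X : Type*} (d ρ : X → X → ℝ) : Prop :=
  ∃ κ : ℝ, 0 < κ ∧ ∀ x y, κ⁻¹ * ρ x y ≤ d x y ∧ d x y ≤ κ * ρ x y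

/-- The number `(log₂ C_ρ)⁻¹ ∈ (0, ∞]`, with the convention `1 / 0 = ∞`. -/
def smoothness {X : Type*} (ρ : X → X → ℝ) : ℝ≥0∞ :=
  (ENNReal.ofReal (Real.logb 2 (optConst ρ)))⁻¹

/-- The lower smoothness index `ind(X, d)`. -/
def ind {X : Type*} (d : X → X → ℝ) : ℝ≥0∞ :=
  ⨆ (ρ : X → X → ℝ) (_ : IsQuasiMetric ρ ∧ Equivalent d ρ), smoothness ρ

/-- The supremum defining `ind(X, d)` is attained. -/
def IndAttained {X : Type*} (d : X → X → ℝ) : Prop :=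
  ∃ ρ : X → X → ℝ, IsQuasiMetric ρ ∧ Equivalent d ρ ∧ smoothness ρ = ind d

/-- The relation `α ⪯_q ind(X, d)`: one has `α ≤ ind(X, d)`, and equality is permitted only if
`q = ∞` and the supremum defining `ind(X, d)` is attained. -/
def Admissible {X : Type*} (d : X → X → ℝ) (α : ℝ) (q : ℝ≥0∞) : Prop :=
  ENNReal.ofReal α ≤ ind d ∧ (ENNReal.ofReal α = ind d → q = ∞ ∧ IndAttained d)

/-- The topology `τ_d`: a set is open if it contains a ball around each of its points. -/
@[reducible] def qtopology {X : Type*} (d : X → X → ℝ) : TopologicalSpace X where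
  IsOpen O := ∀ x ∈ O, ∃ r : ℝ, 0 < r ∧ qball d x r ⊆ O
  isOpen_univ := fun _ _ => ⟨1, one_pos, Set.subset_univ _⟩
  isOpen_inter := by
    intro s t hs ht x hx
    obtain ⟨r, hr, hrs⟩ := hs x hx.1
    obtain ⟨r', hr', hrt⟩ := ht x hx.2
    refine ⟨min r r', lt_min hr hr', fun y hy => ⟨hrs ?_, hrt ?_⟩⟩
    · exact lt_of_lt_of_le (show d x y < min r r' from hy) (min_le_left _ _)
    · exact lt_of_lt_of_le (show d x y < min r r' from hy) (min_le_right _ _)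
  isOpen_sUnion := by
    intro S hS x hx
    obtain ⟨s, hsS, hxs⟩ := hx
    obtain ⟨r, hr, hrs⟩ := hS s hsS x hxs
    exact ⟨r, hr, fun y hy => ⟨s, hsS, hrs hy⟩⟩

/-- `(X, d, μ)` is a quasi-metric-measure space. The sigma-algebra on which `μ` is defined
contains the Borel sets of `τ_d` but may be larger. -/
structure IsQuasiMetricMeasureSpace {X : Type*} [mX : MeasurableSpace X]
    (d : X → X → ℝ) (μ : Measure X) : Prop where
  isQuasiMetric : IsQuasiMetric d
  borel_le : @borel X (qtopology d) ≤ mX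
  measurableSet_qball : ∀ (x : X) (r : ℝ), 0 < r → MeasurableSet (qball d x r)
  measure_qball_pos : ∀ (x : X) (r : ℝ), 0 < r → 0 < μ (qball d x r)
  measure_qball_lt_top : ∀ (x : X) (r : ℝ), 0 < r → μ (qball d x r) < ∞

/-- `μ` is `(c, δ)`-doubling with respect to `d`. -/
def IsDoublingAt {X : Type*} [MeasurableSpace X] (d : X → X → ℝ) (μ : Measure X)
    (c δ : ℝ) : Prop :=
  ∃ C : ℝ, 1 ≤ C ∧ ∀ x : X, μ (qball d x (c * δ)) ≤ ENNReal.ofReal C * μ (qball d x δ)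

/-- `(X, d)` is totally bounded: it is covered by finitely many balls of any given radius. -/
def IsTotallyBounded {X : Type*} (d : X → X → ℝ) : Prop :=
  ∀ ε : ℝ, 0 < ε → ∃ t : Finset X, (⋃ x ∈ t, qball d x ε) = Set.univ

/-- The measure `μ` is integrable: for some quasi-metric `ρ ≈ d` and every `r > 0`, the function
`x ↦ μ(B_ρ(x, r))` is well defined and measurable, and its reciprocal has finite integral. -/
def IsIntegrableMeasure {X : Type*} [MeasurableSpace X] (d : X → X → ℝ) (μ : Measure X) : Prop :=
  ∃ ρ : X → X → ℝ, IsQuasiMetric ρ ∧ Equivalent d ρ ∧ ∀ r : ℝ, 0 < r →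
    (∀ x, MeasurableSet (qball ρ x r)) ∧ Measurable (fun x => μ (qball ρ x r)) ∧
      ∫⁻ x, (μ (qball ρ x r))⁻¹ ∂μ < ∞

/-- `g = (g_k)_{k ∈ ℤ}` is an `α`-fractional gradient of `u`. Values in `[0, ∞]` are allowed. -/
def IsFracGradient {X : Type*} [MeasurableSpace X] (d : X → X → ℝ) (μ : Measure X) (α : ℝ)
    (u : X → ℝ) (g : ℤ → X → ℝ≥0∞) : Prop :=
  (∀ k, Measurable (g k)) ∧ ∃ E : Set X, MeasurableSet E ∧ μ E = 0 ∧
    ∀ (k : ℤ) (x y : X), x ∉ E → y ∉ E →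
      (2 : ℝ) ^ (-k - 1) ≤ d x y → d x y < (2 : ℝ) ^ (-k) →
        ENNReal.ofReal |u x - u y| ≤ ENNReal.ofReal (d x y ^ α) * (g k x + g k y)

/-- The `ℓ^q(ℤ)` (quasi-)norm of a sequence of elements of `[0, ∞]`, for `q ∈ (0, ∞]`. -/
def ellNorm (q : ℝ≥0∞) (a : ℤ → ℝ≥0∞) : ℝ≥0∞ :=
  if q = ∞ then ⨆ k, a k else (∑' k, a k ^ q.toReal) ^ (1 / q.toReal)

/-- The homogeneous Hajłasz–Triebel–Lizorkin semi-norm (`∞` if there is no gradient of finite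
mixed norm). -/
def homSeminormM {X : Type*} [MeasurableSpace X] (d : X → X → ℝ) (μ : Measure X) (α : ℝ)
    (p q : ℝ≥0∞) (u : X → ℝ) : ℝ≥0∞ :=
  ⨅ (g : ℤ → X → ℝ≥0∞) (_ : IsFracGradient d μ α u g),
    eLpNorm (fun x => ellNorm q (fun k => g k x)) p μ

/-- The homogeneous Hajłasz–Besov semi-norm (`∞` if there is no gradient of finite mixed norm). -/
def homSeminormN {X : Type*} [MeasurableSpace X] (d : X → X → ℝ) (μ : Measure X) (α : ℝ)
    (p q : ℝ≥0∞) (u : X → ℝ) : ℝ≥0∞ :=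
  ⨅ (g : ℤ → X → ℝ≥0∞) (_ : IsFracGradient d μ α u g),
    ellNorm q (fun k => eLpNorm (g k) p μ)

/-- The inhomogeneous Hajłasz–Triebel–Lizorkin space `M^α_{p,q}(X, d, μ)`. -/
def spaceM {X : Type*} [MeasurableSpace X] (d : X → X → ℝ) (μ : Measure X) (α : ℝ)
    (p q : ℝ≥0∞) : Set (X → ℝ) :=
  {u | Measurable u ∧ MemLp u p μ ∧ homSeminormM d μ α p q u < ∞}

/-- The (quasi-)norm of `M^α_{p,q}(X, d, μ)`. -/
def normM {X : Type*} [MeasurableSpace X] (d : X → X → ℝ) (μ : Measure X) (α : ℝ)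
    (p q : ℝ≥0∞) (u : X → ℝ) : ℝ≥0∞ :=
  eLpNorm u p μ + homSeminormM d μ α p q u

/-- The inhomogeneous Hajłasz–Besov space `N^α_{p,q}(X, d, μ)`. -/
def spaceN {X : Type*} [MeasurableSpace X] (d : X → X → ℝ) (μ : Measure X) (α : ℝ)
    (p q : ℝ≥0∞) : Set (X → ℝ) :=
  {u | Measurable u ∧ MemLp u p μ ∧ homSeminormN d μ α p q u < ∞}

/-- The (quasi-)norm of `N^α_{p,q}(X, d, μ)`. -/
def normN {X : Type*} [MeasurableSpace X] (d : X → X → ℝ) (μ : Measure X) (α : ℝ)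
    (p q : ℝ≥0∞) (u : X → ℝ) : ℝ≥0∞ :=
  eLpNorm u p μ + homSeminormN d μ α p q u

/-- A function space `S ⊆ L^p(X, μ)` with (quasi-)norm `N` embeds compactly into `L^p(X, μ)`:
`S` is contained in `L^p(X, μ)`, and every sequence that is bounded in `S` has a subsequence
that converges in `L^p(X, μ)`. -/
def EmbedsCompactly {X : Type*} [MeasurableSpace X] (S : Set (X → ℝ)) (N : (X → ℝ) → ℝ≥0∞)
    (p : ℝ≥0∞) (μ : Measure X) : Prop :=
  (∀ u ∈ S, MemLp u p μ) ∧
  ∀ u : ℕ → X → ℝ, (∀ n, u n ∈ S) → (∃ C : ℝ≥0∞, C < ∞ ∧ ∀ n, N (u n) ≤ C) →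
    ∃ (f : X → ℝ) (φ : ℕ → ℕ), MemLp f p μ ∧ StrictMono φ ∧
      Tendsto (fun n => eLpNorm (u (φ n) - f) p μ) atTop (𝓝 0)

/-- The embedding `M^α_{p,q}(X, d, μ) ↪ L^p(X, μ)` is compact. -/
def CompactEmbM {X : Type*} [MeasurableSpace X] (d : X → X → ℝ) (μ : Measure X) (α : ℝ)
    (p q : ℝ≥0∞) : Prop :=
  EmbedsCompactly (spaceM d μ α p q) (normM d μ α p q) p μ

/-- The embedding `N^α_{p,q}(X, d, μ) ↪ L^p(X, μ)` is compact. -/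
def CompactEmbN {X : Type*} [MeasurableSpace X] (d : X → X → ℝ) (μ : Measure X) (α : ℝ)
    (p q : ℝ≥0∞) : Prop :=
  EmbedsCompactly (spaceN d μ α p q) (normN d μ α p q) p μ

end QuasiMetric

end

/-!
A quasi-metric is, up to equivalence, a power of a metric: if `ρ ≈ d` and `C_ρ ^ β ≤ 2`, the chain
metric of the symmetrized `ρ ^ β` is comparable to `ρ ^ β` (Frink's lemma), so that
`d ≈ m ^ (1 / β)` for a metric `m`. Balls of `m` have measurable volume, and Lipschitz cut-offs for
`m` are `β`-Hölder for `d`.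

If `X` is totally bounded, then `μ X < ∞` and the measures of balls of a fixed radius are bounded
below, which makes `μ` integrable. Moreover an `α`-fractional gradient bounded in `L^p` controls the
oscillation of `u` on balls of radius `2 ^ (-K)` by a function whose `L^p`-norm is a geometric tail,
of order `2 ^ (-K α)`. Functions bounded in `N^α_{p,∞}`, which contains every `M^α_{p,q}` and
`N^α_{p,q}`, are therefore uniformly approximable in `L^p` by step functions, and compactness
follows.

If `X` is not totally bounded, it contains infinitely many disjoint balls of a fixed radius. By
doubling each contributes a fixed amount to the integral of `1 / μ (B_ρ(x, r))`, and the normalized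
bump functions supported in them are bounded in `M^α_{p,q}` and `N^α_{p,q}` but uniformly separated
in `L^p`. The smoothness budget `α < β`, or `α = β` and `q = ∞`, makes the fractional gradients of
these bumps `ℓ^q`-summable over the scales. If `C_d = 1` the doubling hypothesis relates no two
scales, but then `d` is a quasi-ultrametric and the indicators of balls are Hölder continuous.
-/

namespace QuasiMetric

section Basic

variable {X : Type*} {d ρ σ : X → X → ℝ}

theorem mem_qball {x y : X} {r : ℝ} : y ∈ qball d x r ↔ d x y < r := Iff.rfl

theorem qball_mono (x : X) {r s : ℝ} (h : r ≤ s) : qball d x r ⊆ qball d x s :=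
  fun _ hy => lt_of_lt_of_le hy h

namespace IsQuasiMetric

theorem self (hd : IsQuasiMetric d) (x : X) : d x x = 0 :=
  (hd.eq_zero_iff x x).2 rfl

theorem pos (hd : IsQuasiMetric d) {x y : X} (h : x ≠ y) : 0 < d x y :=
  (hd.nonneg x y).lt_of_ne' fun h₀ => h ((hd.eq_zero_iff x y).1 h₀)

theorem max_pos (hd : IsQuasiMetric d) {x y z : X} (h : ¬ (x = y ∧ y = z)) :
    0 < max (d x z) (d z y) := by
  rcases eq_or_ne x z with rfl | hxz
  · exact lt_max_of_lt_right (hd.pos fun hxy => h ⟨hxy, hxy.symm⟩)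
  · exact lt_max_of_lt_left (hd.pos hxz)

theorem bddAbove_ratios (hd : IsQuasiMetric d) :
    BddAbove {t : ℝ | ∃ x y z : X, ¬ (x = y ∧ y = z) ∧ t = d x y / max (d x z) (d z y)} := by
  obtain ⟨C, -, hC⟩ := hd.quasi_triangle
  refine ⟨C, ?_⟩
  rintro t ⟨x, y, z, hne, rfl⟩
  exact (div_le_iff₀ (hd.max_pos hne)).2 (hC x y z)

theorem le_optConst_mul_max (hd : IsQuasiMetric d) (x y z : X) :
    d x y ≤ optConst d * max (d x z) (d z y) := by
  by_cases h : x = y ∧ y = z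
  · obtain ⟨rfl, rfl⟩ := h
    simp [hd.self]
  · exact (div_le_iff₀ (hd.max_pos h)).1 (le_csSup hd.bddAbove_ratios ⟨x, y, z, h, rfl⟩)

theorem one_le_optConst [Nontrivial X] (hd : IsQuasiMetric d) : 1 ≤ optConst d := by
  obtain ⟨x, y, hxy⟩ := exists_pair_ne X
  refine le_csSup hd.bddAbove_ratios ⟨x, y, y, fun h => hxy h.1, ?_⟩
  rw [hd.self, max_eq_left (hd.nonneg x y), div_self (hd.pos hxy).ne']

theorem qball_subset_qball_optConst_mul [Nontrivial X] (hd : IsQuasiMetric d) {x y : X} {r : ℝ}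
    (hy : y ∈ qball d x r) : qball d y r ⊆ qball d x (optConst d * r) := fun z hz =>
  (hd.le_optConst_mul_max x z y).trans_lt
    (mul_lt_mul_of_pos_left (max_lt hy hz) (zero_lt_one.trans_le hd.one_le_optConst))

theorem exists_le_mul_max (hd : IsQuasiMetric d) :
    ∃ A : ℝ, 0 < A ∧ ∀ x y z, d x y ≤ A * max (d z x) (d z y) ∧
      d x y ≤ A * max (d x z) (d y z) := by
  obtain ⟨C₀, -, hsymm⟩ := hd.quasi_symm
  obtain ⟨C₁, hC₁, htri⟩ := hd.quasi_triangle
  set M := max C₀ 1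
  have hM : 1 ≤ M := le_max_right _ _
  have hswap : ∀ x y, d x y ≤ M * d y x := fun x y =>
    (hsymm y x).trans (mul_le_mul_of_nonneg_right (le_max_left _ _) (hd.nonneg y x))
  have hself : ∀ x y, d x y ≤ M * d x y := fun x y => le_mul_of_one_le_left (hd.nonneg x y) hM
  refine ⟨C₁ * M, by positivity, fun x y z => ?_⟩
  simp only [mul_assoc, mul_max_of_nonneg _ _ (zero_le_one.trans hM)]
  exact ⟨(htri x y z).trans (by gcongr; exacts [hswap x z, hself z y]),
    (htri x y z).trans (by gcongr; exacts [hself x z, hswap z y])⟩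

theorem exists_forall_mem_qball_lt (hd : IsQuasiMetric d) {r : ℝ} (hr : 0 < r) :
    ∃ ε : ℝ, 0 < ε ∧ ∀ z, ∀ x ∈ qball d z ε, ∀ y ∈ qball d z ε, d x y < r := by
  obtain ⟨A, hA, h⟩ := hd.exists_le_mul_max
  refine ⟨r / A, by positivity, fun z x hx y hy => (h x y z).1.trans_lt ?_⟩
  exact (lt_div_iff₀' hA).1 (max_lt hx hy)

theorem exists_disjoint_qball (hd : IsQuasiMetric d) {ε : ℝ} (hε : 0 < ε) :
    ∃ R : ℝ, 0 < R ∧ ∀ x y, ε ≤ d x y → Disjoint (qball d x R) (qball d y R) := by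
  obtain ⟨A, hA, h⟩ := hd.exists_le_mul_max
  refine ⟨ε / A, by positivity, fun x y hxy => Set.disjoint_left.2 fun z hzx hzy => ?_⟩
  exact (hxy.trans (h x y z).2).not_gt ((lt_div_iff₀' hA).1 (max_lt hzx hzy))

theorem exists_seq_pairwise_disjoint_qball (hd : IsQuasiMetric d) (h : ¬ IsTotallyBounded d) :
    ∃ (x : ℕ → X) (R : ℝ), 0 < R ∧
      Pairwise fun m n => Disjoint (qball d (x m) R) (qball d (x n) R) := by
  unfold IsTotallyBounded at h
  push Not at h
  obtain ⟨ε, hε, hcover⟩ := h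
  obtain ⟨x, -, hsep⟩ := exists_seq_of_forall_finset_exists (fun _ : X => True)
    (fun x y => ε ≤ d x y) fun t _ => by
      obtain ⟨y, hy⟩ := (Set.ne_univ_iff_exists_notMem _).1 (hcover t)
      simp only [Set.mem_iUnion, not_exists, mem_qball, not_lt] at hy
      exact ⟨y, trivial, hy⟩
  obtain ⟨R, hR, hdisj⟩ := hd.exists_disjoint_qball hε
  exact ⟨x, R, hR, (pairwise_disjoint_on _).2 fun m n hmn => hdisj _ _ (hsep m n hmn)⟩

end IsQuasiMetric

namespace Equivalent

theorem refl (d : X → X → ℝ) : Equivalent d d :=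
  ⟨1, one_pos, fun x y => by simp⟩

theorem exists_le_mul (h : Equivalent d ρ) :
    ∃ κ : ℝ, 0 < κ ∧ ∀ x y, d x y ≤ κ * ρ x y ∧ ρ x y ≤ κ * d x y := by
  obtain ⟨κ, hκ, h⟩ := h
  exact ⟨κ, hκ, fun x y => ⟨(h x y).2, (inv_mul_le_iff₀ hκ).1 (h x y).1⟩⟩

theorem symm (h : Equivalent d ρ) : Equivalent ρ d := by
  obtain ⟨κ, hκ, h⟩ := h.exists_le_mul
  exact ⟨κ, hκ, fun x y => ⟨(inv_mul_le_iff₀ hκ).2 (h x y).1, (h x y).2⟩⟩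

theorem of_le_mul {κ L : ℝ} (hκ : 0 < κ) (hd : ∀ x y, 0 ≤ d x y) (hρ : ∀ x y, 0 ≤ ρ x y)
    (h₁ : ∀ x y, d x y ≤ κ * ρ x y) (h₂ : ∀ x y, ρ x y ≤ L * d x y) : Equivalent d ρ :=
  ⟨max κ L, lt_max_of_lt_left hκ, fun x y =>
    ⟨(inv_mul_le_iff₀ (lt_max_of_lt_left hκ)).2
      ((h₂ x y).trans (mul_le_mul_of_nonneg_right (le_max_right _ _) (hd x y))),
      (h₁ x y).trans (mul_le_mul_of_nonneg_right (le_max_left _ _) (hρ x y))⟩⟩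

theorem trans (h : Equivalent d ρ) (h' : Equivalent ρ σ) : Equivalent d σ := by
  obtain ⟨κ, hκ, h⟩ := h
  obtain ⟨L, hL, h'⟩ := h'
  refine ⟨κ * L, mul_pos hκ hL, fun x y => ⟨?_, ?_⟩⟩
  · rw [mul_inv, mul_assoc]
    exact (mul_le_mul_of_nonneg_left (h' x y).1 (inv_nonneg.2 hκ.le)).trans (h x y).1
  · rw [mul_assoc]
    exact (h x y).2.trans (mul_le_mul_of_nonneg_left (h' x y).2 hκ.le)

theorem exists_qball_subset (h : Equivalent d ρ) {r : ℝ} (hr : 0 < r) :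
    ∃ s : ℝ, 0 < s ∧ ∀ x, qball d x s ⊆ qball ρ x r := by
  obtain ⟨κ, hκ, h⟩ := h.exists_le_mul
  exact ⟨r / κ, by positivity, fun x y hy =>
    (h x y).2.trans_lt ((lt_div_iff₀' hκ).1 hy)⟩

end Equivalent

end Basic

section Frink

variable {X : Type*} {f : X → X → ℝ}

/-- The midpoint of the link from `x m` to `x (m + 1)` when the chain `x 0, x 1, …` is laid out on
the real line, starting at the origin, with each link `x l, x (l + 1)` having length
`f (x l) (x (l + 1))`. Measuring between midpoints makes the bound `le_four_mul_linkMidpoint_sub`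
additive at an interior link, which is what its inductive proof needs. -/
noncomputable def linkMidpoint (f : X → X → ℝ) (x : ℕ → X) (m : ℕ) : ℝ :=
  ∑ l ∈ Finset.range m, f (x l) (x (l + 1)) + f (x m) (x (m + 1)) / 2

theorem add_le_two_mul_linkMidpoint_sub (hf₀ : ∀ a b, 0 ≤ f a b) (x : ℕ → X) {a b : ℕ}
    (hab : a < b) :
    f (x a) (x (a + 1)) + f (x b) (x (b + 1)) ≤ 2 * (linkMidpoint f x b - linkMidpoint f x a) := by
  have hsum := Finset.sum_le_sum_of_subset_of_nonneg (Finset.range_subset_range.2 hab)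
    fun m _ _ => hf₀ (x m) (x (m + 1))
  rw [Finset.sum_range_succ] at hsum
  unfold linkMidpoint
  linarith

theorem exists_link_le_two_mul (hf₀ : ∀ a b, 0 ≤ f a b)
    (hf : ∀ a b c, f a b ≤ 2 * max (f a c) (f c b)) (x : ℕ → X) {a b : ℕ} (hab : a ≤ b) :
    ∃ k, a ≤ k ∧ k ≤ b ∧ f (x a) (x (b + 1)) ≤ 2 * f (x a) (x (k + 1)) ∧
      f (x a) (x (b + 1)) ≤ 2 * f (x k) (x (b + 1)) := by
  classical
  have htriv : f (x a) (x (b + 1)) ≤ 2 * f (x a) (x (b + 1)) := by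
    linarith [hf₀ (x a) (x (b + 1))]
  have hex : ∃ k, a ≤ k ∧ f (x a) (x (b + 1)) ≤ 2 * f (x a) (x (k + 1)) := ⟨b, hab, htriv⟩
  obtain ⟨hak, hk⟩ := Nat.find_spec hex
  refine ⟨Nat.find hex, hak, Nat.find_le ⟨hab, htriv⟩, hk, ?_⟩
  rcases hak.eq_or_lt with hak | hak
  · rwa [← hak]
  · obtain ⟨j, hj⟩ : ∃ j, Nat.find hex = j + 1 := ⟨Nat.find hex - 1, by omega⟩
    have hmin := Nat.find_min hex (show j < Nat.find hex by omega)
    have hmax := hf (x a) (x (b + 1)) (x (j + 1))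
    rw [mul_max_of_nonneg _ _ zero_le_two] at hmax
    rw [hj]
    exact (le_max_iff.1 hmax).resolve_left fun h => hmin ⟨by omega, h⟩

theorem le_four_mul_linkMidpoint_sub (hf₀ : ∀ a b, 0 ≤ f a b)
    (hf : ∀ a b c, f a b ≤ 2 * max (f a c) (f c b)) (x : ℕ → X) {a b : ℕ} (hab : a < b) :
    f (x a) (x (b + 1)) ≤ 4 * (linkMidpoint f x b - linkMidpoint f x a) := by
  induction hn : b - a using Nat.strong_induction_on generalizing a b with
  | _ n ih =>
    obtain ⟨k, hak, hkb, hleft, hright⟩ := exists_link_le_two_mul hf₀ hf x hab.le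
    have houter := add_le_two_mul_linkMidpoint_sub hf₀ x hab
    rcases hak.eq_or_lt with rfl | hak
    · linarith [hf₀ (x b) (x (b + 1))]
    rcases hkb.eq_or_lt with rfl | hkb
    · linarith [hf₀ (x a) (x (a + 1))]
    have hak' := ih (k - a) (by omega) hak rfl
    have hkb' := ih (b - k) (by omega) hkb rfl
    linarith

theorem le_four_mul_sum_range (hf₀ : ∀ a b, 0 ≤ f a b)
    (hf : ∀ a b c, f a b ≤ 2 * max (f a c) (f c b)) (x : ℕ → X) (n : ℕ) :
    f (x 0) (x (n + 1)) ≤ 4 * ∑ m ∈ Finset.range (n + 1), f (x m) (x (m + 1)) := by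
  rw [Finset.sum_range_succ]
  rcases n.eq_zero_or_pos with rfl | hn
  · rw [Finset.sum_range_zero]
    linarith [hf₀ (x 0) (x 1)]
  · have h := le_four_mul_linkMidpoint_sub hf₀ hf x hn
    simp only [linkMidpoint, Finset.sum_range_zero] at h
    linarith [hf₀ (x 0) (x 1), hf₀ (x n) (x (n + 1))]

theorem exists_seq_sum_zipWith_eq {M : Type*} [AddCommMonoid M] (f : X → X → M) (l : List X)
    (x y : X) :
    ∃ s : ℕ → X, s 0 = x ∧ s (l.length + 1) = y ∧
      (List.zipWith f (x :: l) (l ++ [y])).sum =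
        ∑ m ∈ Finset.range (l.length + 1), f (s m) (s (m + 1)) := by
  induction l generalizing x with
  | nil => exact ⟨fun n => if n = 0 then x else y, by simp, by simp, by simp⟩
  | cons a l ih =>
    obtain ⟨s, hs₀, hs₁, hsum⟩ := ih a
    refine ⟨fun n => Nat.casesOn n x s, rfl, hs₁, ?_⟩
    rw [List.length_cons, Finset.sum_range_succ', List.cons_append, List.zipWith_cons_cons,
      List.sum_cons, hsum, add_comm]
    simp [hs₀]

theorem exists_pseudoMetricSpace_le_and_le_four_mul (hf₀ : ∀ a b, 0 ≤ f a b)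
    (hself : ∀ a, f a a = 0) (hsymm : ∀ a b, f a b = f b a)
    (hf : ∀ a b c, f a b ≤ 2 * max (f a c) (f c b)) :
    ∃ m : PseudoMetricSpace X, ∀ x y, m.dist x y ≤ f x y ∧ f x y ≤ 4 * m.dist x y := by
  lift f to X → X → NNReal using hf₀
  have hself' : ∀ x, f x x = 0 := fun x => NNReal.coe_eq_zero.1 (hself x)
  have hsymm' : ∀ x y, f x y = f y x := fun x y => NNReal.coe_injective (hsymm x y)
  refine ⟨.ofPreNNDist f hself' hsymm', fun x y =>
    ⟨PseudoMetricSpace.dist_ofPreNNDist_le f hself' hsymm' x y, ?_⟩⟩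
  rw [PseudoMetricSpace.dist_ofPreNNDist f hself' hsymm', ← NNReal.coe_ofNat 4, ← NNReal.coe_mul,
    NNReal.mul_iInf, NNReal.coe_le_coe]
  refine le_ciInf fun l => ?_
  obtain ⟨s, rfl, rfl, hsum⟩ := exists_seq_sum_zipWith_eq f l x y
  rw [hsum, ← NNReal.coe_le_coe]
  push_cast
  exact le_four_mul_sum_range (fun a b => (f a b).2) hf s l.length

end Frink

section Metrization

variable {X : Type*} {ρ : X → X → ℝ}

/-- The symmetric quasi-metric `max (ρ x y) (ρ y x)`. It is equivalent to `ρ` and its constant in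
the quasi-ultrametric inequality is no larger. -/
noncomputable def symmetrization (ρ : X → X → ℝ) (x y : X) : ℝ := max (ρ x y) (ρ y x)

theorem symmetrization_comm (ρ : X → X → ℝ) (x y : X) :
    symmetrization ρ x y = symmetrization ρ y x :=
  max_comm _ _

namespace IsQuasiMetric

theorem optConst_nonneg (hρ : IsQuasiMetric ρ) : 0 ≤ optConst ρ :=
  Real.sSup_nonneg fun _ ⟨_, _, _, _, ht⟩ =>
    ht ▸ div_nonneg (hρ.nonneg _ _) (le_max_of_le_left (hρ.nonneg _ _))

theorem symmetrization_nonneg (hρ : IsQuasiMetric ρ) (x y : X) : 0 ≤ symmetrization ρ x y :=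
  le_max_of_le_left (hρ.nonneg x y)

theorem symmetrization_self (hρ : IsQuasiMetric ρ) (x : X) : symmetrization ρ x x = 0 :=
  (max_self _).trans (hρ.self x)

theorem equivalent_symmetrization (hρ : IsQuasiMetric ρ) : Equivalent ρ (symmetrization ρ) := by
  obtain ⟨C, -, hC⟩ := hρ.quasi_symm
  refine .of_le_mul (L := max 1 C) one_pos hρ.nonneg hρ.symmetrization_nonneg
    (fun x y => ?_) fun x y => ?_
  · rw [one_mul]
    exact le_max_left _ _
  · rw [max_mul_of_nonneg _ _ (hρ.nonneg x y), one_mul]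
    exact max_le_max le_rfl (hC x y)

theorem symmetrization_le_optConst_mul_max (hρ : IsQuasiMetric ρ) (x y z : X) :
    symmetrization ρ x y ≤
      optConst ρ * max (symmetrization ρ x z) (symmetrization ρ z y) := by
  refine max_le ((hρ.le_optConst_mul_max x y z).trans ?_)
    ((hρ.le_optConst_mul_max y x z).trans ?_) <;>
    refine mul_le_mul_of_nonneg_left ?_ hρ.optConst_nonneg
  · exact max_le_max (le_max_left _ _) (le_max_left _ _)
  · exact max_comm (ρ y z) (ρ z x) ▸ max_le_max (le_max_right _ _) (le_max_right _ _)

theorem symmetrization_rpow_le_two_mul_max (hρ : IsQuasiMetric ρ) {β : ℝ} (hβ : 0 ≤ β)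
    (hC : optConst ρ ^ β ≤ 2) (x y z : X) :
    symmetrization ρ x y ^ β ≤
      2 * max (symmetrization ρ x z ^ β) (symmetrization ρ z y ^ β) := by
  have hxz := hρ.symmetrization_nonneg x z
  have hzy := hρ.symmetrization_nonneg z y
  rw [← Real.rpow_max hxz hzy hβ]
  calc symmetrization ρ x y ^ β
      ≤ (optConst ρ * max (symmetrization ρ x z) (symmetrization ρ z y)) ^ β :=
        Real.rpow_le_rpow (hρ.symmetrization_nonneg x y)
          (hρ.symmetrization_le_optConst_mul_max x y z) hβ
    _ = optConst ρ ^ β * max (symmetrization ρ x z) (symmetrization ρ z y) ^ β :=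
        Real.mul_rpow hρ.optConst_nonneg (le_max_of_le_left hxz)
    _ ≤ 2 * max (symmetrization ρ x z) (symmetrization ρ z y) ^ β := by gcongr

theorem exists_metricSpace_equivalent_dist_rpow (hρ : IsQuasiMetric ρ) {β : ℝ} (hβ : 0 < β)
    (hC : optConst ρ ^ β ≤ 2) :
    ∃ m : MetricSpace X, Equivalent ρ fun x y => m.dist x y ^ β⁻¹ := by
  obtain ⟨m, hm⟩ := exists_pseudoMetricSpace_le_and_le_four_mul
    (fun x y => Real.rpow_nonneg (hρ.symmetrization_nonneg x y) β)
    (fun x => by rw [hρ.symmetrization_self, Real.zero_rpow hβ.ne'])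
    (fun x y => by rw [symmetrization_comm]) (hρ.symmetrization_rpow_le_two_mul_max hβ.le hC)
  have hequiv : Equivalent ρ fun x y => dist x y ^ β⁻¹ := by
    refine hρ.equivalent_symmetrization.trans <| .of_le_mul (κ := 4 ^ β⁻¹) (L := 1) (by positivity)
      hρ.symmetrization_nonneg (fun x y => by positivity) (fun x y => ?_) fun x y => ?_
    · rw [← Real.mul_rpow (by norm_num) dist_nonneg]
      exact (Real.le_rpow_inv_iff_of_pos (hρ.symmetrization_nonneg x y) (by positivity) hβ).2
        (hm x y).2
    · rw [one_mul, Real.rpow_inv_le_iff_of_pos dist_nonneg (hρ.symmetrization_nonneg x y) hβ]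
      exact (hm x y).1
  refine ⟨{ m with eq_of_dist_eq_zero := fun {x y} hxy => ?_ }, hequiv⟩
  obtain ⟨κ, -, hκ⟩ := hequiv.exists_le_mul
  refine (hρ.eq_zero_iff x y).1 (le_antisymm ((hκ x y).1.trans_eq ?_) (hρ.nonneg x y))
  simp [hxy, hβ.ne']

end IsQuasiMetric

theorem exists_rpow_le_two {C : ℝ} (hC : 1 ≤ C) : ∃ β : ℝ, 0 < β ∧ C ^ β ≤ 2 := by
  rcases hC.eq_or_lt with rfl | hC
  · exact ⟨1, one_pos, by norm_num⟩
  · refine ⟨(Real.logb 2 C)⁻¹, inv_pos.2 (Real.logb_pos one_lt_two hC), le_of_eq ?_⟩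
    rw [Real.inv_logb, Real.rpow_logb (by positivity) hC.ne' two_pos]

end Metrization

section MetricSnowflake

variable {X : Type*} {γ : ℝ}

theorem isQuasiMetric_dist_rpow [MetricSpace X] (hγ : 0 < γ) :
    IsQuasiMetric fun x y : X => dist x y ^ γ where
  nonneg x y := by positivity
  eq_zero_iff x y := by rw [Real.rpow_eq_zero dist_nonneg hγ.ne', dist_eq_zero]
  quasi_symm := ⟨1, one_pos, fun x y => by rw [dist_comm, one_mul]⟩
  quasi_triangle := by
    refine ⟨2 ^ γ, by positivity, fun x y z => ?_⟩
    rw [← Real.rpow_max dist_nonneg dist_nonneg hγ.le,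
      ← Real.mul_rpow zero_le_two (le_max_of_le_left dist_nonneg)]
    refine Real.rpow_le_rpow dist_nonneg ((dist_triangle x z y).trans ?_) hγ.le
    rw [two_mul]
    exact add_le_add (le_max_left _ _) (le_max_right _ _)

theorem qball_dist_rpow [PseudoMetricSpace X] (hγ : 0 < γ) (x : X) {r : ℝ} (hr : 0 ≤ r) :
    qball (fun x y => dist x y ^ γ) x r = Metric.ball x (r ^ γ⁻¹) := by
  ext y
  rw [mem_qball, Metric.mem_ball', Real.lt_rpow_inv_iff_of_pos dist_nonneg hr hγ]

theorem lowerSemicontinuous_measure_ball [PseudoMetricSpace X] [MeasurableSpace X]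
    (μ : Measure X) (r : ℝ) : LowerSemicontinuous fun x => μ (Metric.ball x r) := by
  intro x t ht
  have hball : Metric.ball x r = ⋃ n : ℕ, Metric.ball x (r - 1 / ((n : ℝ) + 1)) := by
    refine subset_antisymm (fun y hy => ?_) (Set.iUnion_subset fun n =>
      Metric.ball_subset_ball (sub_le_self r (by positivity)))
    obtain ⟨n, hn⟩ := exists_nat_one_div_lt (sub_pos.2 (Metric.mem_ball.1 hy))
    exact Set.mem_iUnion.2 ⟨n, Metric.mem_ball.2 (by linarith)⟩
  have hmono : Monotone fun n : ℕ => Metric.ball x (r - 1 / ((n : ℝ) + 1)) := fun m n hmn =>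
    Metric.ball_subset_ball (sub_le_sub_left (Nat.one_div_le_one_div hmn) r)
  change t < μ (Metric.ball x r) at ht
  rw [hball, hmono.measure_iUnion, lt_iSup_iff] at ht
  obtain ⟨n, hn⟩ := ht
  filter_upwards [Metric.ball_mem_nhds x (Nat.one_div_pos_of_nat (n := n))] with y hy
  refine hn.trans_le (measure_mono (Metric.ball_subset_ball' ?_))
  linarith [Metric.mem_ball'.1 hy]

end MetricSnowflake

section Integrable

variable {X : Type*} [MeasurableSpace X] {d : X → X → ℝ} {μ : Measure X}

/-- `μ` is `(c, δ)`-doubling with respect to `d` at all scales `δ ∈ (0, δ₀]`. -/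
def IsDoublingUpTo (d : X → X → ℝ) (μ : Measure X) (c δ₀ : ℝ) : Prop :=
  ∀ δ : ℝ, 0 < δ → δ ≤ δ₀ → IsDoublingAt d μ c δ

theorem inv_le_setLIntegral_inv {f : X → ℝ≥0∞} {B : Set X} {C : ℝ≥0∞} (hB : MeasurableSet B)
    (hB₀ : μ B ≠ 0) (hB' : μ B ≠ ∞) (hf : ∀ y ∈ B, f y ≤ C * μ B) :
    C⁻¹ ≤ ∫⁻ y in B, (f y)⁻¹ ∂μ :=
  calc C⁻¹ = (C * μ B)⁻¹ * μ B := by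
        rw [ENNReal.mul_inv (.inr hB') (.inr hB₀), mul_assoc, ENNReal.inv_mul_cancel hB₀ hB',
          mul_one]
    _ = ∫⁻ _ in B, (C * μ B)⁻¹ ∂μ := (setLIntegral_const _ _).symm
    _ ≤ ∫⁻ y in B, (f y)⁻¹ ∂μ :=
        setLIntegral_mono' hB fun y hy => ENNReal.inv_le_inv.2 (hf y hy)

namespace IsQuasiMetricMeasureSpace

theorem opensMeasurableSpace [PseudoMetricSpace X] {γ : ℝ} (hX : IsQuasiMetricMeasureSpace d μ)
    (hγ : 0 < γ) (h : Equivalent d fun x y => dist x y ^ γ) : OpensMeasurableSpace X := by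
  refine ⟨MeasurableSpace.generateFrom_le fun O hO =>
    hX.borel_le O (MeasurableSpace.measurableSet_generateFrom fun x hx => ?_)⟩
  obtain ⟨ε, hε, hεO⟩ := Metric.isOpen_iff.1 hO x hx
  obtain ⟨s, hs, hsub⟩ := h.exists_qball_subset (r := ε ^ γ) (by positivity)
  refine ⟨s, hs, (hsub x).trans ?_⟩
  rwa [qball_dist_rpow hγ x (by positivity), Real.rpow_rpow_inv hε.le hγ.ne']

theorem measure_univ_lt_top (hX : IsQuasiMetricMeasureSpace d μ) (h : IsTotallyBounded d) :
    μ Set.univ < ∞ := by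
  obtain ⟨t, ht⟩ := h 1 one_pos
  rw [← ht]
  exact (measure_biUnion_finset_le _ _).trans_lt
    (ENNReal.sum_lt_top.2 fun x _ => hX.measure_qball_lt_top x 1 one_pos)

theorem exists_pos_forall_le_measure_qball (hX : IsQuasiMetricMeasureSpace d μ)
    (h : IsTotallyBounded d) {r : ℝ} (hr : 0 < r) :
    ∃ c : ℝ≥0∞, 0 < c ∧ ∀ x, c ≤ μ (qball d x r) := by
  obtain ⟨ε, hε, hsmall⟩ := hX.isQuasiMetric.exists_forall_mem_qball_lt hr
  obtain ⟨t, ht⟩ := h ε hε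
  refine ⟨t.inf fun z => μ (qball d z ε),
    (Finset.lt_inf_iff ENNReal.zero_lt_top).2 fun z _ => hX.measure_qball_pos z ε hε, fun x => ?_⟩
  obtain ⟨z, hz, hxz⟩ := Set.mem_iUnion₂.1 (ht.ge (Set.mem_univ x))
  exact (Finset.inf_le hz).trans (measure_mono fun y hy => hsmall z x hxz y hy)

theorem isIntegrableMeasure_of_isTotallyBounded [Nontrivial X]
    (hX : IsQuasiMetricMeasureSpace d μ) (h : IsTotallyBounded d) : IsIntegrableMeasure d μ := by
  have hd := hX.isQuasiMetric
  obtain ⟨β, hβ, hβC⟩ := exists_rpow_le_two hd.one_le_optConst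
  obtain ⟨m, hequiv⟩ := hd.exists_metricSpace_equivalent_dist_rpow hβ hβC
  have hγ : 0 < β⁻¹ := inv_pos.2 hβ
  have := hX.opensMeasurableSpace hγ hequiv
  refine ⟨_, isQuasiMetric_dist_rpow hγ, hequiv, fun r hr => ⟨fun x => ?_, ?_, ?_⟩⟩
  · rw [qball_dist_rpow hγ x hr.le]
    exact measurableSet_ball
  · simp only [qball_dist_rpow hγ _ hr.le]
    exact (lowerSemicontinuous_measure_ball μ _).measurable
  · obtain ⟨s, hs, hsub⟩ := hequiv.exists_qball_subset hr
    obtain ⟨c, hc, hcle⟩ := hX.exists_pos_forall_le_measure_qball h hs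
    calc ∫⁻ x, (μ (qball (fun x y => dist x y ^ β⁻¹) x r))⁻¹ ∂μ
        ≤ ∫⁻ _, c⁻¹ ∂μ := lintegral_mono fun x =>
          ENNReal.inv_le_inv.2 ((hcle x).trans (measure_mono (hsub x)))
      _ = c⁻¹ * μ Set.univ := lintegral_const _
      _ < ∞ := ENNReal.mul_lt_top (ENNReal.inv_lt_top.2 hc) (hX.measure_univ_lt_top h)

theorem isTotallyBounded_of_isIntegrableMeasure [Nontrivial X] {δ₀ : ℝ}
    (hX : IsQuasiMetricMeasureSpace d μ) (hδ₀ : 0 < δ₀)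
    (hdoub : IsDoublingUpTo d μ (optConst d) δ₀) (h : IsIntegrableMeasure d μ) :
    IsTotallyBounded d := by
  have hd := hX.isQuasiMetric
  by_contra hnot
  obtain ⟨x, R, hR, hdisj⟩ := hd.exists_seq_pairwise_disjoint_qball hnot
  set s := min R δ₀
  have hs : 0 < s := lt_min hR hδ₀
  obtain ⟨C, -, hC⟩ := hdoub s hs (min_le_right _ _)
  obtain ⟨ρ, -, hdρ, hint⟩ := h
  obtain ⟨r, hr, hsub⟩ := hdρ.symm.exists_qball_subset hs
  have hdisj' : Pairwise fun m n => Disjoint (qball d (x m) s) (qball d (x n) s) :=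
    fun m n hmn => (hdisj hmn).mono (qball_mono _ (min_le_left _ _))
      (qball_mono _ (min_le_left _ _))
  have hball : ∀ n, (ENNReal.ofReal C)⁻¹ ≤
      ∫⁻ y in qball d (x n) s, (μ (qball ρ y r))⁻¹ ∂μ := fun n =>
    inv_le_setLIntegral_inv (hX.measurableSet_qball _ _ hs) (hX.measure_qball_pos _ _ hs).ne'
      (hX.measure_qball_lt_top _ _ hs).ne fun y hy => (measure_mono
        ((hsub y).trans (hd.qball_subset_qball_optConst_mul hy))).trans (hC (x n))
  refine (hint r hr).2.2.not_ge ?_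
  calc (∞ : ℝ≥0∞) = ∑' _ : ℕ, (ENNReal.ofReal C)⁻¹ :=
        (ENNReal.tsum_const_eq_top_of_ne_zero (by simp)).symm
    _ ≤ ∑' n, ∫⁻ y in qball d (x n) s, (μ (qball ρ y r))⁻¹ ∂μ := ENNReal.tsum_le_tsum hball
    _ = ∫⁻ y in ⋃ n, qball d (x n) s, (μ (qball ρ y r))⁻¹ ∂μ :=
        (lintegral_iUnion (fun n => hX.measurableSet_qball _ _ hs) hdisj' _).symm
    _ ≤ ∫⁻ y, (μ (qball ρ y r))⁻¹ ∂μ := setLIntegral_le_lintegral _ _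

end IsQuasiMetricMeasureSpace

end Integrable

section Lp

variable {X E ι : Type*} [MeasurableSpace X] {μ : Measure X} {p : ℝ≥0∞}

theorem ae_exists_tendsto_of_tsum_measure_ne_top [PseudoEMetricSpace E] [CompleteSpace E]
    {u : ℕ → X → E} (h : ∑' k, μ {x | 2⁻¹ ^ k ≤ edist (u k x) (u (k + 1) x)} ≠ ∞) :
    ∀ᵐ x ∂μ, ∃ l, Tendsto (fun k => u k x) atTop (𝓝 l) := by
  filter_upwards [ae_eventually_notMem h] with x hx
  obtain ⟨N, hN⟩ := eventually_atTop.1 hx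
  have hcauchy : CauchySeq fun k => u (k + N) x := by
    refine cauchySeq_of_edist_le_geometric 2⁻¹ 1 (by simp) (by simp) fun k => ?_
    have hlt : edist (u (k + N) x) (u (k + N + 1) x) < 2⁻¹ ^ (k + N) :=
      not_le.1 (hN (k + N) (Nat.le_add_left N k))
    rw [one_mul, Nat.add_right_comm]
    exact hlt.le.trans (pow_le_pow_right_of_le_one' (by simp) (Nat.le_add_right k N))
  obtain ⟨l, hl⟩ := cauchySeq_tendsto_of_complete hcauchy
  exact ⟨l, (tendsto_add_atTop_iff_nat N).1 hl⟩

variable [NormedAddCommGroup E]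

theorem exists_pos_forall_measure_le_of_eLpNorm_le (hp₀ : p ≠ 0) (hp : p ≠ ∞) {ε δ : ℝ≥0∞}
    (hε₀ : ε ≠ 0) (hε : ε ≠ ∞) (hδ : δ ≠ 0) :
    ∃ η : ℝ≥0∞, 0 < η ∧ ∀ f : X → E, AEStronglyMeasurable f μ → eLpNorm f p μ ≤ η →
      μ {x | ε ≤ ‖f x‖ₑ} ≤ δ := by
  have hpos : 0 < p.toReal := ENNReal.toReal_pos hp₀ hp
  refine ⟨ε * δ ^ p.toReal⁻¹, by positivity, fun f hf hfη => ?_⟩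
  calc μ {x | ε ≤ ‖f x‖ₑ}
      ≤ (ε⁻¹ * eLpNorm f p μ) ^ p.toReal := by
        rw [ENNReal.mul_rpow_of_nonneg _ _ hpos.le]
        exact meas_ge_le_mul_pow_eLpNorm_enorm μ hp₀ hp hf hε₀ fun h => absurd h hε
    _ ≤ (ε⁻¹ * (ε * δ ^ p.toReal⁻¹)) ^ p.toReal := by gcongr
    _ = δ := by rw [ENNReal.inv_mul_cancel_left hε₀ hε, ENNReal.rpow_inv_rpow hpos.ne']

theorem exists_tendsto_eLpNorm_sub_of_cauchy [CompleteSpace E] (hp₀ : p ≠ 0) (hp : p ≠ ∞)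
    {u : ℕ → X → E} (hu : ∀ n, AEStronglyMeasurable (u n) μ)
    (hcauchy : ∀ ε : ℝ≥0∞, 0 < ε → ∃ N, ∀ m ≥ N, ∀ n ≥ N, eLpNorm (u m - u n) p μ ≤ ε) :
    ∃ f : X → E, AEStronglyMeasurable f μ ∧
      Tendsto (fun n => eLpNorm (u n - f) p μ) atTop (𝓝 0) := by
  have hmeasure : ∀ k : ℕ, ∃ N, ∀ m ≥ N, ∀ n ≥ N,
      μ {x | 2⁻¹ ^ k ≤ ‖(u m - u n) x‖ₑ} ≤ 2⁻¹ ^ k := fun k => by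
    obtain ⟨η, hη, hηle⟩ := exists_pos_forall_measure_le_of_eLpNorm_le (μ := μ) (E := E) hp₀ hp
      (ε := 2⁻¹ ^ k) (δ := 2⁻¹ ^ k) (by simp) (by simp) (by simp)
    obtain ⟨N, hN⟩ := hcauchy η hη
    exact ⟨N, fun m hm n hn => hηle _ ((hu m).sub (hu n)) (hN m hm n hn)⟩
  obtain ⟨φ, hφ, hφle⟩ := extraction_forall_of_eventually'
    (P := fun k m => ∀ n ≥ m, μ {x | 2⁻¹ ^ k ≤ ‖(u m - u n) x‖ₑ} ≤ 2⁻¹ ^ k)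
    fun k => (hmeasure k).imp fun N hN m hm n hn => hN m hm n (hm.trans hn)
  have hsum : ∑' k, μ {x | 2⁻¹ ^ k ≤ edist (u (φ k) x) (u (φ (k + 1)) x)} ≠ ∞ := by
    refine ne_top_of_le_ne_top ?_ (ENNReal.tsum_le_tsum fun k => ?_) (b := ∑' k, 2⁻¹ ^ k)
    · simp [ENNReal.tsum_geometric]
    · simpa only [edist_eq_enorm_sub, Pi.sub_apply] using hφle k _ (hφ.monotone k.le_succ)
  obtain ⟨f, hf, hlim⟩ := exists_stronglyMeasurable_limit_of_tendsto_ae (fun k => hu (φ k))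
    (ae_exists_tendsto_of_tsum_measure_ne_top hsum)
  refine ⟨f, hf.aestronglyMeasurable, ENNReal.tendsto_atTop_zero.2 fun ε hε => ?_⟩
  obtain ⟨N, hN⟩ := hcauchy ε hε
  refine ⟨N, fun n hn => Lp.eLpNorm_le_of_ae_tendsto (f := fun k => u n - u (φ k)) (u := atTop) ?_
    (fun k => (hu n).sub (hu (φ k))) ?_⟩
  · filter_upwards [hφ.tendsto_atTop.eventually_ge_atTop N] with k hk using hN n hn _ hk
  · filter_upwards [hlim] with x hx using tendsto_const_nhds.sub hx

theorem tendsto_eLpNorm_comp_sub_comp_zero [Finite ι] [IsFiniteMeasure μ] (i : X → ι)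
    {c : ℕ → ι → E} {a : ι → E} (hc : Tendsto c atTop (𝓝 a)) :
    Tendsto (fun n => eLpNorm (c n ∘ i - a ∘ i) p μ) atTop (𝓝 0) := by
  cases nonempty_fintype ι
  have hle : ∀ n, eLpNorm (c n ∘ i - a ∘ i) p μ ≤
      μ Set.univ ^ p.toReal⁻¹ * ENNReal.ofReal ‖c n - a‖ := fun n =>
    eLpNorm_le_of_ae_bound <| ae_of_all _ fun x => norm_le_pi_norm (c n - a) (i x)
  refine tendsto_of_tendsto_of_tendsto_of_le_of_le tendsto_const_nhds ?_ (fun _ => zero_le) hle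
  have hnorm := ENNReal.tendsto_ofReal (tendsto_iff_norm_sub_tendsto_zero.1 hc)
  rw [ENNReal.ofReal_zero] at hnorm
  simpa only [mul_zero] using ENNReal.Tendsto.const_mul hnorm <| Or.inr <|
    ENNReal.rpow_ne_top_of_nonneg (inv_nonneg.2 ENNReal.toReal_nonneg) (measure_ne_top μ _)

/-- The sequence `u` is uniformly approximable in `L^p` by step functions over finite measurable
partitions, the partition and the bounds on the values depending only on the accuracy. A partition
is encoded by the measurable map sending a point to the index of its cell. -/
def IsStepApproximable (μ : Measure X) (p : ℝ≥0∞) (u : ℕ → X → ℝ) : Prop :=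
  ∀ η : NNReal, 0 < η → ∃ (N : ℕ) (i : X → Fin N) (M : Fin N → ℝ), Measurable i ∧
    ∀ n, ∃ c : Fin N → ℝ, (∀ k, |c k| ≤ M k) ∧ eLpNorm (u n - c ∘ i) p μ ≤ η

theorem exists_eLpNorm_sub_lt_of_close (p : ℝ≥0∞) (μ : Measure X) {ε : ℝ≥0∞} (hε : ε ≠ 0) :
    ∃ η : ℝ≥0∞, 0 < η ∧ ∀ f g h : X → E, AEStronglyMeasurable f μ → AEStronglyMeasurable g μ →
      AEStronglyMeasurable h μ → eLpNorm (f - h) p μ ≤ η → eLpNorm (g - h) p μ ≤ η →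
        eLpNorm (f - g) p μ < ε := by
  obtain ⟨η, hη, hηlt⟩ := exists_Lp_half E μ p hε
  refine ⟨η, hη, fun f g h hf hg hh hfh hgh => ?_⟩
  rw [← sub_add_sub_cancel f h g]
  exact hηlt _ _ (hf.sub hh) (hh.sub hg) hfh (by rwa [eLpNorm_sub_comm])

/-- The diagonal argument: the coefficients for all accuracies converge along one subsequence, by
compactness of a countable product of boxes. -/
theorem IsStepApproximable.exists_subseq_tendsto [IsFiniteMeasure μ] (hp₀ : p ≠ 0) (hp : p ≠ ∞)
    {u : ℕ → X → ℝ} (happ : IsStepApproximable μ p u) (hu : ∀ n, AEStronglyMeasurable (u n) μ) :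
    ∃ (f : X → ℝ) (φ : ℕ → ℕ), AEStronglyMeasurable f μ ∧ StrictMono φ ∧
      Tendsto (fun n => eLpNorm (u (φ n) - f) p μ) atTop (𝓝 0) := by
  obtain ⟨η, -, hη, hη₀⟩ := exists_seq_strictAnti_tendsto (0 : NNReal)
  choose N i M hi c hcM hc using fun m => happ (η m) (hη m)
  have hcompact : IsCompact (Set.univ.pi fun m => Set.univ.pi fun k => Set.Icc (-M m k) (M m k)) :=
    isCompact_univ_pi fun m => isCompact_univ_pi fun k => isCompact_Icc
  obtain ⟨a, -, φ, hφ, ha⟩ := hcompact.tendsto_subseq (x := fun n m => c m n)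
    fun n m _ k _ => abs_le.1 (hcM m n k)
  have hstep : ∀ m (b : Fin (N m) → ℝ), AEStronglyMeasurable (b ∘ i m) μ := fun m b =>
    ((measurable_of_finite b).comp (hi m)).aestronglyMeasurable
  have hcauchy : ∀ ε : ℝ≥0∞, 0 < ε →
      ∃ n₀, ∀ n ≥ n₀, ∀ n' ≥ n₀, eLpNorm (u (φ n) - u (φ n')) p μ ≤ ε := fun ε hε => by
    obtain ⟨ε', hε', hlt⟩ := exists_eLpNorm_sub_lt_of_close (E := ℝ) p μ hε.ne'
    obtain ⟨ε'', hε'', hlt'⟩ := exists_eLpNorm_sub_lt_of_close (E := ℝ) p μ hε'.ne'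
    obtain ⟨m, hm⟩ := ((ENNReal.tendsto_coe.2 hη₀).eventually (Iio_mem_nhds hε'')).exists
    obtain ⟨n₀, hn₀⟩ := ENNReal.tendsto_atTop_zero.1 (tendsto_eLpNorm_comp_sub_comp_zero
      (p := p) (μ := μ) (i m) ((continuous_apply m).tendsto a |>.comp ha)) ε'' hε''
    have hclose : ∀ n ≥ n₀, eLpNorm (u (φ n) - a m ∘ i m) p μ ≤ ε' := fun n hn =>
      (hlt' _ _ (c m (φ n) ∘ i m) (hu _) (hstep m _) (hstep m _) ((hc m (φ n)).trans hm.le)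
        (by rw [eLpNorm_sub_comm]; exact hn₀ n hn)).le
    exact ⟨n₀, fun n hn n' hn' =>
      (hlt _ _ (a m ∘ i m) (hu _) (hu _) (hstep m _) (hclose n hn) (hclose n' hn')).le⟩
  obtain ⟨f, hf, hlim⟩ := exists_tendsto_eLpNorm_sub_of_cauchy hp₀ hp (fun n => hu (φ n)) hcauchy
  exact ⟨f, φ, hf, hφ, hlim⟩

end Lp

section Compactness

theorem IsQuasiMetric.exists_dyadic_scale {X : Type*} {d : X → X → ℝ} (hd : IsQuasiMetric d)
    {x y : X} (hxy : x ≠ y) : ∃ k : ℤ, (2 : ℝ) ^ (-k - 1) ≤ d x y ∧ d x y < 2 ^ (-k) := by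
  obtain ⟨n, hn⟩ := exists_mem_Ico_zpow (hd.pos hxy) one_lt_two
  exact ⟨-n - 1, by simpa [add_comm] using hn⟩

theorem exists_mem_forall_le_add {X : Type*} {s : Set X} (hs : s.Nonempty) (H : X → ℝ≥0∞)
    {η : ℝ≥0∞} (hη : η ≠ 0) : ∃ y ∈ s, ∀ x ∈ s, H y ≤ H x + η := by
  obtain hinf | hinf := eq_or_ne (⨅ x ∈ s, H x) ∞
  · simp only [iInf_eq_top] at hinf
    exact hs.imp fun y hy => ⟨hy, fun x hx => by simp [hinf x hx]⟩
  · obtain ⟨y, hy, hlt⟩ : ∃ y ∈ s, H y < (⨅ x ∈ s, H x) + η := by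
      simpa only [iInf_lt_iff, exists_prop] using ENNReal.lt_add_right hinf hη
    exact ⟨y, hy, fun x hx => hlt.le.trans (by gcongr; exact iInf₂_le x hx)⟩

variable {X ι : Type*} [MeasurableSpace X] {d : X → X → ℝ} {μ : Measure X} {α : ℝ} {p q : ℝ≥0∞}

theorem eLpNorm_iSup_rpow_le_tsum [Countable ι] (hp₀ : p ≠ 0) (hp : p ≠ ∞) {f : ι → X → ℝ≥0∞}
    (hf : ∀ j, Measurable (f j)) :
    eLpNorm (fun x => ⨆ j, f j x) p μ ^ p.toReal ≤ ∑' j, eLpNorm (f j) p μ ^ p.toReal := by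
  have hpos : 0 < p.toReal := ENNReal.toReal_pos hp₀ hp
  have hrpow : ∀ h : X → ℝ≥0∞, eLpNorm h p μ ^ p.toReal = ∫⁻ x, h x ^ p.toReal ∂μ := fun h => by
    rw [eLpNorm_eq_lintegral_rpow_enorm_toReal hp₀ hp, one_div, ENNReal.rpow_inv_rpow hpos.ne']
    rfl
  simp only [hrpow]
  rw [← lintegral_tsum fun j => ((hf j).pow_const _).aemeasurable]
  refine lintegral_mono fun x => ?_
  calc (⨆ j, f j x) ^ p.toReal = ⨆ j, f j x ^ p.toReal :=
        (ENNReal.orderIsoRpow p.toReal hpos).map_iSup _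
    _ ≤ ∑' j, f j x ^ p.toReal := iSup_le fun j => ENNReal.le_tsum j

/-- The function `H` controls, outside a null set, the oscillation of `u` at scales below `r`. -/
def IsOscillationBound (d : X → X → ℝ) (μ : Measure X) (r : ℝ) (u : X → ℝ) (H : X → ℝ≥0∞) : Prop :=
  ∃ E : Set X, μ E = 0 ∧ ∀ x ∉ E, ∀ y ∉ E, d x y < r → ‖u x - u y‖ₑ ≤ H x + H y

theorem IsFracGradient.isOscillationBound_iSup (hd : IsQuasiMetric d) (hα : 0 ≤ α) {u : X → ℝ}
    {g : ℤ → X → ℝ≥0∞} (hg : IsFracGradient d μ α u g) (K : ℕ) :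
    IsOscillationBound d μ (2 ^ (-K : ℤ)) u fun x =>
      ⨆ j : ℕ, ↑(((2 : NNReal) ^ (-α)) ^ (j + K)) * g ↑(j + K) x := by
  obtain ⟨-, E, -, hE, hgE⟩ := hg
  refine ⟨E, hE, fun x hx y hy hxy => ?_⟩
  rcases eq_or_ne x y with rfl | hne
  · simp
  obtain ⟨k, hk, hk'⟩ := hd.exists_dyadic_scale hne
  have hKk : -k - 1 < -(K : ℤ) := (zpow_lt_zpow_iff_right₀ one_lt_two).1 (hk.trans_lt hxy)
  obtain ⟨m, rfl⟩ := Int.eq_ofNat_of_zero_le (show 0 ≤ k by lia)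
  obtain ⟨j, rfl⟩ := Nat.exists_eq_add_of_le' (show K ≤ m by lia)
  have hweight : ENNReal.ofReal (d x y ^ α) ≤ ↑(((2 : NNReal) ^ (-α)) ^ (j + K)) := by
    rw [← ENNReal.ofReal_coe_nnreal]
    refine ENNReal.ofReal_le_ofReal ?_
    calc d x y ^ α ≤ ((2 : ℝ) ^ (-((j + K : ℕ) : ℤ))) ^ α :=
          Real.rpow_le_rpow (hd.nonneg x y) hk'.le hα
      _ = ((2 : ℝ) ^ (-α)) ^ (j + K) := by
          rw [← Real.rpow_intCast, ← Real.rpow_natCast, ← Real.rpow_mul zero_le_two,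
            ← Real.rpow_mul zero_le_two]
          push_cast
          ring_nf
      _ = _ := by push_cast; rfl
  calc ‖u x - u y‖ₑ
      ≤ ↑(((2 : NNReal) ^ (-α)) ^ (j + K)) * (g ↑(j + K) x + g ↑(j + K) y) := by
        rw [Real.enorm_eq_ofReal_abs]
        exact (hgE _ x y hx hy hk hk').trans (by gcongr)
    _ ≤ _ := by
        rw [mul_add]
        exact add_le_add
          (le_iSup (fun j : ℕ => ↑(((2 : NNReal) ^ (-α)) ^ (j + K)) * g ↑(j + K) x) j)
          (le_iSup (fun j : ℕ => ↑(((2 : NNReal) ^ (-α)) ^ (j + K)) * g ↑(j + K) y) j)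

theorem tendsto_tsum_geometric_tail_rpow {θ : NNReal} (hθ : θ < 1) {s : ℝ} (hs : 0 < s) {A : ℝ≥0∞}
    (hA : A ≠ ∞) :
    Tendsto (fun K : ℕ => ∑' j : ℕ, (((θ ^ (j + K) : NNReal) : ℝ≥0∞) * A) ^ s) atTop (𝓝 0) := by
  refine ENNReal.tendsto_sum_nat_add (fun m => (((θ ^ m : NNReal) : ℝ≥0∞) * A) ^ s) ?_
  have hterm : ∀ m : ℕ, (((θ ^ m : NNReal) : ℝ≥0∞) * A) ^ s = ((θ : ℝ≥0∞) ^ s) ^ m * A ^ s :=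
    fun m => by
      rw [ENNReal.mul_rpow_of_nonneg _ _ hs.le, ENNReal.coe_pow, ← ENNReal.rpow_natCast,
        ← ENNReal.rpow_natCast, ← ENNReal.rpow_mul, ← ENNReal.rpow_mul, mul_comm s]
  have hθs : (θ : ℝ≥0∞) ^ s < 1 := ENNReal.rpow_lt_one (by exact_mod_cast hθ) hs
  simp only [hterm, ENNReal.tsum_mul_right, ENNReal.tsum_geometric]
  exact ENNReal.mul_ne_top (ENNReal.inv_ne_top.2 (tsub_pos_of_lt hθs).ne')
    (ENNReal.rpow_ne_top_of_nonneg hs.le hA)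

theorem IsQuasiMetric.exists_isOscillationBound (hd : IsQuasiMetric d) (hα : 0 < α) (hp₀ : p ≠ 0)
    (hp : p ≠ ∞) {A η : ℝ≥0∞} (hA : A ≠ ∞) (hη : 0 < η) :
    ∃ r : ℝ, 0 < r ∧ ∀ (u : X → ℝ) (g : ℤ → X → ℝ≥0∞), IsFracGradient d μ α u g →
      (∀ k, eLpNorm (g k) p μ ≤ A) →
        ∃ H : X → ℝ≥0∞, Measurable H ∧ IsOscillationBound d μ r u H ∧ eLpNorm H p μ ≤ η := by
  have hpos : 0 < p.toReal := ENNReal.toReal_pos hp₀ hp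
  have hθ : (2 : NNReal) ^ (-α) < 1 := NNReal.rpow_lt_one_of_one_lt_of_neg one_lt_two (by simpa)
  obtain ⟨K, hK⟩ := ((tendsto_tsum_geometric_tail_rpow hθ hpos hA).eventually
    (Iio_mem_nhds (ENNReal.rpow_pos_of_nonneg hη hpos.le))).exists
  refine ⟨2 ^ (-K : ℤ), by positivity, fun u g hg hgA =>
    ⟨_, ?_, hg.isOscillationBound_iSup hd hα.le K, ?_⟩⟩
  · exact .iSup fun j => (hg.1 _).const_mul _
  rw [← ENNReal.rpow_le_rpow_iff hpos]
  calc _ ≤ _ := eLpNorm_iSup_rpow_le_tsum hp₀ hp fun j => (hg.1 _).const_mul _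
    _ ≤ ∑' j : ℕ, (↑(((2 : NNReal) ^ (-α)) ^ (j + K)) * A) ^ p.toReal := by
        gcongr with j
        refine (eLpNorm_le_nnreal_smul_eLpNorm_of_ae_le_mul' (g := g ↑(j + K))
          (ae_of_all _ fun x => le_rfl) p).trans ?_
        exact mul_le_mul_right (hgA _) _
    _ ≤ η ^ p.toReal := hK.le

theorem IsOscillationBound.exists_const_enorm_sub_le {r : ℝ} {u : X → ℝ} {H : X → ℝ≥0∞}
    (h : IsOscillationBound d μ r u H) {B : Set X} (hB : μ B ≠ 0)
    (hBr : ∀ x ∈ B, ∀ y ∈ B, d x y < r) {η : ℝ≥0∞} (hη : η ≠ 0) :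
    ∃ c : ℝ, ∀ᵐ x ∂μ, x ∈ B → ‖u x - c‖ₑ ≤ H x + H x + η := by
  obtain ⟨E, hE, hEH⟩ := h
  have hne : (B \ E).Nonempty := by
    refine nonempty_of_measure_ne_zero (μ := μ) ?_
    rwa [measure_sdiff_null hE]
  obtain ⟨y, hy, hyH⟩ := exists_mem_forall_le_add hne H hη
  refine ⟨u y, ?_⟩
  filter_upwards [measure_eq_zero_iff_ae_notMem.1 hE] with x hxE hxB
  rw [add_assoc]
  exact (hEH x hxE y hy.2 (hBr x hxB y hy.1)).trans (by gcongr; exact hyH x ⟨hxB, hxE⟩)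

theorem enorm_mul_measure_rpow_le_eLpNorm (hp₀ : p ≠ 0) (hp : p ≠ ∞) {B : Set X}
    (hB : MeasurableSet B) {c : ℝ} {F : X → ℝ≥0∞} (h : ∀ᵐ x ∂μ, x ∈ B → ‖c‖ₑ ≤ F x) :
    ‖c‖ₑ * μ B ^ (1 / p.toReal) ≤ eLpNorm F p μ := by
  rw [← eLpNorm_indicator_const hB hp₀ hp]
  refine eLpNorm_mono_enorm_ae ?_
  filter_upwards [h] with x hx
  by_cases hxB : x ∈ B
  · simpa [hxB] using hx hxB
  · simp [hxB]

theorem exists_measurable_mem_qball (hB : ∀ x r, 0 < r → MeasurableSet (qball d x r))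
    (h : IsTotallyBounded d) {ε : ℝ} (hε : 0 < ε) :
    ∃ (N : ℕ) (z : Fin N → X) (i : X → Fin N), Measurable i ∧ ∀ x, x ∈ qball d (z (i x)) ε := by
  classical
  obtain ⟨t, ht⟩ := h ε hε
  let z : Fin t.card → X := fun k => t.equivFin.symm k
  have hcover : ∀ x, ∃ k, x ∈ qball d (z k) ε := fun x => by
    obtain ⟨y, hy, hxy⟩ := Set.mem_iUnion₂.1 (ht.ge (Set.mem_univ x))
    exact ⟨t.equivFin ⟨y, hy⟩, by simpa [z] using hxy⟩
  refine ⟨t.card, z, fun x => Fin.find _ (hcover x), measurable_to_countable' fun k => ?_,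
    fun x => Fin.find_spec (hcover x)⟩
  have hpreimage : (fun x => Fin.find _ (hcover x)) ⁻¹' {k} =
      qball d (z k) ε \ ⋃ l ∈ Finset.Iio k, qball d (z l) ε := by
    ext x
    simp [Fin.find_eq_iff]
  rw [hpreimage]
  exact (hB _ _ hε).diff (Finset.measurableSet_biUnion _ fun l _ => hB _ _ hε)

theorem IsOscillationBound.exists_step_approx (hp₀ : p ≠ 0) (hp : p ≠ ∞) [Countable ι]
    {B : ι → Set X} (hB : ∀ k, MeasurableSet (B k)) (hμB : ∀ k, μ (B k) ≠ 0) {r : ℝ}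
    (hBr : ∀ k, ∀ x ∈ B k, ∀ y ∈ B k, d x y < r) {i : X → ι} (hi : ∀ x, x ∈ B (i x))
    {u : X → ℝ} {H : X → ℝ≥0∞} (h : IsOscillationBound d μ r u H) {η : ℝ≥0∞} (hη : η ≠ 0) :
    ∃ c : ι → ℝ, eLpNorm (u - c ∘ i) p μ ≤ eLpNorm (fun x => H x + H x + η) p μ ∧
      ∀ k, ‖c k‖ₑ * μ (B k) ^ (1 / p.toReal) ≤
        eLpNorm (fun x => ‖u x‖ₑ + (H x + H x + η)) p μ := by
  choose c hc using fun k => h.exists_const_enorm_sub_le (hμB k) (hBr k) hη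
  refine ⟨c, eLpNorm_mono_enorm_ae ?_, fun k => enorm_mul_measure_rpow_le_eLpNorm hp₀ hp (hB k) ?_⟩
  · filter_upwards [ae_all_iff.2 hc] with x hx using hx (i x) (hi x)
  · filter_upwards [hc k] with x hx hxB
    calc ‖c k‖ₑ = ‖u x - (u x - c k)‖ₑ := by rw [sub_sub_cancel]
      _ ≤ ‖u x‖ₑ + ‖u x - c k‖ₑ := enorm_sub_le
      _ ≤ _ := by gcongr; exact hx hxB

theorem exists_forall_eLpNorm_add_self_add_const_le [IsFiniteMeasure μ] {η : ℝ≥0∞} (hη : η ≠ 0) :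
    ∃ η' : ℝ≥0∞, 0 < η' ∧ ∀ H : X → ℝ≥0∞, Measurable H → eLpNorm H p μ ≤ η' →
      eLpNorm (fun x => H x + H x + η') p μ ≤ η := by
  obtain ⟨η₁, hη₁, hsum₁⟩ := exists_Lp_half ℝ≥0∞ μ p hη
  obtain ⟨η₂, hη₂, hsum₂⟩ := exists_Lp_half ℝ≥0∞ μ p hη₁.ne'
  have hμ : μ Set.univ ^ p.toReal⁻¹ ≠ ∞ :=
    ENNReal.rpow_ne_top_of_nonneg (inv_nonneg.2 ENNReal.toReal_nonneg) (measure_ne_top μ _)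
  refine ⟨min η₂ (η₁ / μ Set.univ ^ p.toReal⁻¹), lt_min hη₂ (ENNReal.div_pos hη₁.ne' hμ),
    fun H hH hHη => (hsum₁ _ _ (hH.add hH).aestronglyMeasurable aestronglyMeasurable_const
      (hsum₂ _ _ hH.aestronglyMeasurable hH.aestronglyMeasurable (hHη.trans (min_le_left _ _))
        (hHη.trans (min_le_left _ _))).le ?_).le⟩
  calc _ ≤ min η₂ (η₁ / μ Set.univ ^ p.toReal⁻¹) * μ Set.univ ^ p.toReal⁻¹ :=
        eLpNorm_le_of_ae_enorm_bound (ae_of_all _ fun _ => le_rfl)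
    _ ≤ η₁ / μ Set.univ ^ p.toReal⁻¹ * μ Set.univ ^ p.toReal⁻¹ := by gcongr; exact min_le_right _ _
    _ ≤ η₁ := by rw [mul_comm]; exact ENNReal.mul_div_le

theorem IsQuasiMetricMeasureSpace.isStepApproximable (hX : IsQuasiMetricMeasureSpace d μ)
    [IsFiniteMeasure μ] (h : IsTotallyBounded d) (hα : 0 < α) (hp₀ : p ≠ 0) (hp : p ≠ ∞)
    {A : ℝ≥0∞} (hA : A ≠ ∞) {u : ℕ → X → ℝ} (hu : ∀ n, Measurable (u n))
    (huA : ∀ n, eLpNorm (u n) p μ ≤ A) {g : ℕ → ℤ → X → ℝ≥0∞}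
    (hg : ∀ n, IsFracGradient d μ α (u n) (g n)) (hgA : ∀ n k, eLpNorm (g n k) p μ ≤ A) :
    IsStepApproximable μ p u := by
  intro η hη
  obtain ⟨η', hη', hsum⟩ := exists_forall_eLpNorm_add_self_add_const_le (p := p) (μ := μ)
    (ENNReal.coe_ne_zero.2 hη.ne')
  obtain ⟨r, hr, hosc⟩ := hX.isQuasiMetric.exists_isOscillationBound (μ := μ) hα hp₀ hp hA hη'
  choose H hHmeas hH hHη using fun n => hosc (u n) (g n) (hg n) (hgA n)
  obtain ⟨ε, hε, hεr⟩ := hX.isQuasiMetric.exists_forall_mem_qball_lt hr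
  obtain ⟨N, z, i, hi, hiz⟩ := exists_measurable_mem_qball hX.measurableSet_qball h hε
  have hμB : ∀ k, μ (qball d (z k) ε) ^ (1 / p.toReal) ≠ 0 := fun k =>
    (ENNReal.rpow_pos (hX.measure_qball_pos _ ε hε) (hX.measure_qball_lt_top _ ε hε).ne).ne'
  let Q : ℝ≥0∞ := ENNReal.LpAddConst p * (A + η)
  have hQ : Q ≠ ∞ :=
    ENNReal.mul_ne_top (ENNReal.LpAddConst_lt_top p).ne
      (ENNReal.add_ne_top.2 ⟨hA, ENNReal.coe_ne_top⟩)
  refine ⟨N, i, fun k => (Q / μ (qball d (z k) ε) ^ (1 / p.toReal)).toReal, hi, fun n => ?_⟩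
  obtain ⟨c, hc, hcB⟩ := (hH n).exists_step_approx hp₀ hp
    (fun k => hX.measurableSet_qball (z k) ε hε) (fun k => (hX.measure_qball_pos (z k) ε hε).ne')
    (fun k => hεr (z k)) hiz hη'.ne'
  refine ⟨c, fun k => ?_, hc.trans (hsum _ (hHmeas n) (hHη n))⟩
  rw [← ENNReal.ofReal_le_iff_le_toReal (ENNReal.div_ne_top hQ (hμB k)), ← Real.enorm_eq_ofReal_abs]
  refine ENNReal.le_div_iff_mul_le (.inl (hμB k)) (.inr hQ) |>.2 ((hcB k).trans ?_)
  have hmeas : Measurable fun x => H n x + H n x + η' := by fun_prop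
  calc _ ≤ ENNReal.LpAddConst p * (eLpNorm (fun x => ‖u n x‖ₑ) p μ +
          eLpNorm (fun x => H n x + H n x + η') p μ) :=
        eLpNorm_add_le' (hu n).enorm.aestronglyMeasurable hmeas.aestronglyMeasurable p
    _ ≤ Q := by
        rw [eLpNorm_enorm]
        exact mul_le_mul_right (add_le_add (huA n) (hsum _ (hHmeas n) (hHη n))) _

theorem IsQuasiMetricMeasureSpace.compactEmbN_top_of_isTotallyBounded
    (hX : IsQuasiMetricMeasureSpace d μ) (h : IsTotallyBounded d) (hα : 0 < α) (hp₀ : p ≠ 0)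
    (hp : p ≠ ∞) : CompactEmbN d μ α p ∞ := by
  refine ⟨fun u hu => hu.2.1, fun u hu ⟨C, hC, huC⟩ => ?_⟩
  have : IsFiniteMeasure μ := ⟨hX.measure_univ_lt_top h⟩
  have hgrad : ∀ n, ∃ g, IsFracGradient d μ α (u n) g ∧ ∀ k, eLpNorm (g k) p μ ≤ C + 1 :=
      fun n => by
    have hlt : homSeminormN d μ α p ∞ (u n) < C + 1 :=
      (le_add_self.trans (huC n)).trans_lt (ENNReal.lt_add_right hC.ne one_ne_zero)
    simp only [homSeminormN, ellNorm, if_true, iInf_lt_iff] at hlt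
    obtain ⟨g, hg, hgC⟩ := hlt
    exact ⟨g, hg, fun k => (le_iSup _ k).trans hgC.le⟩
  choose g hg hgC using hgrad
  have happ := hX.isStepApproximable h hα hp₀ hp (ENNReal.add_ne_top.2 ⟨hC.ne, ENNReal.one_ne_top⟩)
    (fun n => (hu n).1) (fun n => le_self_add.trans ((huC n).trans le_self_add)) hg hgC
  obtain ⟨f, φ, hf, hφ, hlim⟩ := happ.exists_subseq_tendsto hp₀ hp fun n =>
    (hu n).1.aestronglyMeasurable
  refine ⟨f, φ, ?_, hφ, hlim⟩
  obtain ⟨n, hn⟩ := (hlim.eventually (Iio_mem_nhds one_pos)).exists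
  have hsub : MemLp (u (φ n) - f) p μ :=
    ⟨(hu _).1.aestronglyMeasurable.sub hf, hn.trans ENNReal.one_lt_top⟩
  simpa only [sub_sub_cancel] using (hu (φ n)).2.1.sub hsub

theorem EmbedsCompactly.mono {S T : Set (X → ℝ)} {M N : (X → ℝ) → ℝ≥0∞}
    (h : EmbedsCompactly T N p μ) (hST : S ⊆ T) (hNM : ∀ u, N u ≤ M u) : EmbedsCompactly S M p μ :=
  ⟨fun u hu => h.1 u (hST hu), fun u hu ⟨C, hC, huC⟩ =>
    h.2 u (fun n => hST (hu n)) ⟨C, hC, fun n => (hNM _).trans (huC n)⟩⟩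

theorem le_ellNorm (hq : q ≠ 0) (a : ℤ → ℝ≥0∞) (k : ℤ) : a k ≤ ellNorm q a := by
  unfold ellNorm
  split_ifs with h
  · exact le_iSup a k
  · rw [one_div, ENNReal.le_rpow_inv_iff (ENNReal.toReal_pos hq h)]
    exact ENNReal.le_tsum k

theorem homSeminormN_top_le_homSeminormM (hq : q ≠ 0) (u : X → ℝ) :
    homSeminormN d μ α p ∞ u ≤ homSeminormM d μ α p q u := by
  refine iInf₂_mono fun g _ => ?_
  simp only [ellNorm, if_true]
  exact iSup_le fun k => eLpNorm_mono_enorm fun x => le_ellNorm hq (fun k => g k x) k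

theorem homSeminormN_top_le_homSeminormN (hq : q ≠ 0) (u : X → ℝ) :
    homSeminormN d μ α p ∞ u ≤ homSeminormN d μ α p q u := by
  refine iInf₂_mono fun g _ => ?_
  simp only [ellNorm, if_true]
  exact iSup_le fun k => le_ellNorm hq (fun k => eLpNorm (g k) p μ) k

theorem IsQuasiMetricMeasureSpace.compactEmbM_of_isTotallyBounded
    (hX : IsQuasiMetricMeasureSpace d μ) (h : IsTotallyBounded d) (hα : 0 < α) (hp₀ : p ≠ 0)
    (hp : p ≠ ∞) (hq : q ≠ 0) : CompactEmbM d μ α p q :=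
  (hX.compactEmbN_top_of_isTotallyBounded h hα hp₀ hp).mono
    (fun u hu => ⟨hu.1, hu.2.1, (homSeminormN_top_le_homSeminormM hq u).trans_lt hu.2.2⟩)
    fun u => add_le_add_right (homSeminormN_top_le_homSeminormM hq u) _

theorem IsQuasiMetricMeasureSpace.compactEmbN_of_isTotallyBounded
    (hX : IsQuasiMetricMeasureSpace d μ) (h : IsTotallyBounded d) (hα : 0 < α) (hp₀ : p ≠ 0)
    (hp : p ≠ ∞) (hq : q ≠ 0) : CompactEmbN d μ α p q :=
  (hX.compactEmbN_top_of_isTotallyBounded h hα hp₀ hp).mono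
    (fun u hu => ⟨hu.1, hu.2.1, (homSeminormN_top_le_homSeminormN hq u).trans_lt hu.2.2⟩)
    fun u => add_le_add_right (homSeminormN_top_le_homSeminormN hq u) _

end Compactness

section Admissible

variable {X : Type*} {d ρ : X → X → ℝ} {α β : ℝ} {q : ℝ≥0∞}

theorem IsQuasiMetric.optConst_rpow_le_two_of_le_smoothness [Nontrivial X]
    (hρ : IsQuasiMetric ρ) (hβ : 0 < β) (h : ENNReal.ofReal β ≤ smoothness ρ) :
    optConst ρ ^ β ≤ 2 := by
  have hC : 0 < optConst ρ := one_pos.trans_le hρ.one_le_optConst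
  rw [smoothness, ENNReal.le_inv_iff_mul_le, ← ENNReal.ofReal_mul hβ.le, ENNReal.ofReal_le_one] at h
  rwa [← Real.rpow_one 2, ← Real.logb_le_iff_le_rpow one_lt_two (by positivity),
    Real.logb_rpow_eq_mul_logb_of_pos hC]

theorem Admissible.exists_exponent [Nontrivial X] (hα : 0 < α) (h : Admissible d α q) :
    ∃ (ρ : X → X → ℝ) (β : ℝ), IsQuasiMetric ρ ∧ Equivalent d ρ ∧ optConst ρ ^ β ≤ 2 ∧ α ≤ β ∧
      (q = ∞ ∨ α < β) := by
  rcases h.1.eq_or_lt with heq | hlt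
  · obtain ⟨hq, ρ, hρ, hdρ, hind⟩ := h.2 heq
    exact ⟨ρ, α, hρ, hdρ, hρ.optConst_rpow_le_two_of_le_smoothness hα (by rw [heq, hind]), le_rfl,
      .inl hq⟩
  · simp only [ind, lt_iSup_iff] at hlt
    obtain ⟨ρ, ⟨hρ, hdρ⟩, hlt⟩ := hlt
    obtain ⟨β, hαβ, hβ⟩ := ENNReal.lt_iff_exists_nnreal_btwn.1 hlt
    rw [← ENNReal.ofReal_coe_nnreal] at hαβ hβ
    replace hαβ : α < β := (ENNReal.ofReal_lt_ofReal_iff_of_nonneg hα.le).1 hαβ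
    exact ⟨ρ, β, hρ, hdρ, hρ.optConst_rpow_le_two_of_le_smoothness (hα.trans hαβ) hβ.le, hαβ.le,
      .inr hαβ⟩

theorem IsQuasiMetric.exists_admissible (hd : IsQuasiMetric d) (q : ℝ≥0∞) :
    ∃ α : ℝ, 0 < α ∧ Admissible d α q := by
  have hind : 0 < ind d := lt_iSup_iff.2 ⟨d, lt_iSup_iff.2
    ⟨⟨hd, Equivalent.refl d⟩, ENNReal.inv_pos.2 ENNReal.ofReal_ne_top⟩⟩
  obtain ⟨α, hα, hαd⟩ := ENNReal.lt_iff_exists_nnreal_btwn.1 hind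
  rw [← ENNReal.ofReal_coe_nnreal] at hαd
  exact ⟨α, by exact_mod_cast hα, hαd.le, fun h => absurd h hαd.ne⟩

end Admissible

section Bumps

variable {X : Type*} {d : X → X → ℝ} {β L : ℝ} {A B : Set X} {φ : X → ℝ}

/-- `φ` is a bump function for `A ⊆ B`: it takes values in `[0, 1]`, equals `1` on `A`, vanishes off
`B`, and is `β`-Hölder continuous with constant `L` with respect to `d`. -/
structure IsHolderBump (d : X → X → ℝ) (β L : ℝ) (A B : Set X) (φ : X → ℝ) : Prop where
  mem_Icc : ∀ x, φ x ∈ Set.Icc 0 1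
  eq_one : ∀ x ∈ A, φ x = 1
  eq_zero : ∀ x ∉ B, φ x = 0
  abs_sub_le : ∀ x y, |φ x - φ y| ≤ L * d x y ^ β

theorem IsHolderBump.abs_sub_le_one (h : IsHolderBump d β L A B φ) (x y : X) : |φ x - φ y| ≤ 1 :=
  Real.dist_le_of_mem_Icc_01 (h.mem_Icc x) (h.mem_Icc y)

/-- In a quasi-ultrametric space a ball lies at a positive distance from its complement. -/
theorem IsQuasiMetric.exists_isHolderBump_indicator_qball (hd : IsQuasiMetric d)
    (hC : optConst d ≤ 1) (hβ : 0 ≤ β) {R : ℝ} (hR : 0 < R) :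
    ∃ L, ∀ x, IsHolderBump d β L (qball d x R) (qball d x R) ((qball d x R).indicator 1) := by
  obtain ⟨C₀, -, hsymm⟩ := hd.quasi_symm
  have hultra : ∀ x y z, d x y < R → R ≤ d x z → R ≤ d y z := fun x y z hxy hxz => by
    by_contra! hyz
    have hmax : 0 ≤ max (d x y) (d y z) := le_max_of_le_left (hd.nonneg x y)
    exact (hxz.trans ((hd.le_optConst_mul_max x z y).trans (mul_le_of_le_one_left hmax hC))).not_gt
      (max_lt hxy hyz)
  set D := max 1 C₀
  have hone : ∀ y z, R ≤ D * d y z → 1 ≤ (D / R) ^ β * d y z ^ β := fun y z h => by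
    rw [← Real.mul_rpow (by positivity) (hd.nonneg y z), div_mul_eq_mul_div]
    exact Real.one_le_rpow ((one_le_div hR).2 h) hβ
  have hsame : ∀ y z, 0 ≤ (D / R) ^ β * d y z ^ β := fun y z =>
    mul_nonneg (by positivity) (Real.rpow_nonneg (hd.nonneg y z) β)
  refine ⟨(D / R) ^ β, fun x => ⟨fun y => ⟨Set.indicator_nonneg (by simp) _,
    Set.indicator_le_self' (by simp) _⟩, fun y hy => by simp [hy], fun y hy => by simp [hy],
    fun y z => ?_⟩⟩
  by_cases hy : y ∈ qball d x R <;> by_cases hz : z ∈ qball d x R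
  · simpa [hy, hz] using hsame y z
  · have hyz : R ≤ d y z := hultra x y z hy (not_lt.1 hz)
    simpa [hy, hz] using hone y z
      (hyz.trans (le_mul_of_one_le_left (hd.nonneg y z) (le_max_left _ _)))
  · have hzy : R ≤ d z y := hultra x z y hz (not_lt.1 hy)
    simpa [hy, hz] using hone y z (hzy.trans ((hsymm y z).trans
      (mul_le_mul_of_nonneg_right (le_max_right _ _) (hd.nonneg y z))))
  · simpa [hy, hz] using hsame y z

theorem exists_continuous_isHolderBump [PseudoMetricSpace X] (hβ : 0 < β)
    (hd : ∀ x y, 0 ≤ d x y) (h : Equivalent d fun x y => dist x y ^ β⁻¹) {R : ℝ} (hR : 0 < R) :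
    ∃ r L : ℝ, 0 < r ∧ ∀ x, ∃ φ : X → ℝ, Continuous φ ∧
      IsHolderBump d β L (qball d x r) (qball d x R) φ := by
  obtain ⟨κ, hκ, hdist⟩ := h.exists_le_mul
  obtain ⟨t, ht, htR⟩ := h.symm.exists_qball_subset hR
  have hs : 0 < t ^ β / 2 := by positivity
  obtain ⟨r, hr, hrs⟩ := h.exists_qball_subset (r := (t ^ β / 2) ^ β⁻¹) (by positivity)
  simp only [qball_dist_rpow (inv_pos.2 hβ) _ ht.le, inv_inv] at htR
  simp only [qball_dist_rpow (inv_pos.2 hβ) _ (Real.rpow_nonneg hs.le _), inv_inv,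
    Real.rpow_inv_rpow hs.le hβ.ne'] at hrs
  set s := t ^ β / 2 with hs_def
  refine ⟨r, s⁻¹ * κ ^ β, hr, fun x => ⟨fun y => thickenedIndicator hs (Metric.ball x s) y,
    by fun_prop, fun y => ⟨by positivity, ?_⟩, fun y hy => ?_, fun y hy => ?_, fun y z => ?_⟩⟩
  · exact_mod_cast thickenedIndicator_le_one hs _ y
  · exact_mod_cast thickenedIndicator_one hs _ (hrs x hy)
  · refine NNReal.coe_eq_zero.2 (thickenedIndicator_zero hs _ fun hyB => hy (htR x ?_))
    obtain ⟨z, hz, hyz⟩ := Metric.mem_thickening_iff.1 hyB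
    rw [Metric.mem_ball] at hz ⊢
    linarith [dist_triangle y z x]
  · rw [mul_assoc, ← Real.mul_rpow hκ.le (hd y z), ← Real.dist_eq]
    refine ((lipschitzWith_thickenedIndicator hs _).dist_le_mul y z).trans ?_
    rw [NNReal.coe_inv, Real.coe_toNNReal _ hs.le]
    gcongr
    rw [← Real.rpow_inv_rpow dist_nonneg hβ.ne']
    gcongr
    exact (hdist y z).2

variable [MeasurableSpace X] {μ : Measure X}

theorem IsDoublingUpTo.exists_measure_qball_le_mul {c δ₀ R r : ℝ} (h : IsDoublingUpTo d μ c δ₀)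
    (hc : 1 < c) (hR : 0 < R) (hRδ : R ≤ δ₀) (hr : 0 < r) :
    ∃ C : ℝ≥0∞, C ≠ ∞ ∧ ∀ x, μ (qball d x R) ≤ C * μ (qball d x r) := by
  have : 0 < c := one_pos.trans hc
  have hpow : ∀ n : ℕ, ∃ C : ℝ≥0∞, C ≠ ∞ ∧
      ∀ x, μ (qball d x R) ≤ C * μ (qball d x (R / c ^ n)) := by
    intro n
    induction n with
    | zero => exact ⟨1, ENNReal.one_ne_top, fun x => by simp⟩
    | succ n ih =>
      obtain ⟨C, hC, hCle⟩ := ih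
      have hle : R / c ^ (n + 1) ≤ R := div_le_self hR.le (one_le_pow₀ hc.le)
      obtain ⟨C', -, hC'le⟩ := h (R / c ^ (n + 1)) (by positivity) (hle.trans hRδ)
      have hstep : c * (R / c ^ (n + 1)) = R / c ^ n := by rw [pow_succ]; field_simp
      rw [hstep] at hC'le
      exact ⟨C * ENNReal.ofReal C', ENNReal.mul_ne_top hC ENNReal.ofReal_ne_top, fun x =>
        (hCle x).trans (by rw [mul_assoc]; exact mul_le_mul_right (hC'le x) C)⟩
  obtain ⟨n, hn⟩ := pow_unbounded_of_one_lt (R / r) hc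
  obtain ⟨C, hC, hCle⟩ := hpow n
  have hRr : R / c ^ n ≤ r := (div_le_comm₀ hr (by positivity)).1 hn.le
  exact ⟨C, hC, fun x => (hCle x).trans (mul_le_mul_right (measure_mono (qball_mono x hRr)) C)⟩

theorem IsQuasiMetricMeasureSpace.exists_isHolderBump
    (hX : IsQuasiMetricMeasureSpace d μ) {δ₀ : ℝ} (hδ₀ : 0 < δ₀)
    (hdoub : IsDoublingUpTo d μ (optConst d) δ₀) {ρ : X → X → ℝ} (hρ : IsQuasiMetric ρ)
    (hdρ : Equivalent d ρ) (hβ : 0 < β) (hC : optConst ρ ^ β ≤ 2) {R₀ : ℝ} (hR₀ : 0 < R₀) :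
    ∃ (r R L : ℝ) (C : ℝ≥0∞), 0 < r ∧ 0 < R ∧ R ≤ R₀ ∧ C ≠ ∞ ∧
      (∀ x, μ (qball d x R) ≤ C * μ (qball d x r)) ∧
      ∀ x, ∃ φ : X → ℝ, Measurable φ ∧ IsHolderBump d β L (qball d x r) (qball d x R) φ := by
  have hd := hX.isQuasiMetric
  rcases le_or_gt (optConst d) 1 with hd₁ | hd₁
  · obtain ⟨L, hL⟩ := hd.exists_isHolderBump_indicator_qball hd₁ hβ.le hR₀
    exact ⟨R₀, R₀, L, 1, hR₀, hR₀, le_rfl, ENNReal.one_ne_top, fun x => (one_mul _).ge, fun x =>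
      ⟨_, measurable_one.indicator (hX.measurableSet_qball x R₀ hR₀), hL x⟩⟩
  · obtain ⟨m, hm⟩ := hρ.exists_metricSpace_equivalent_dist_rpow hβ hC
    have hequiv := hdρ.trans hm
    have := hX.opensMeasurableSpace (inv_pos.2 hβ) hequiv
    have hR : 0 < min R₀ δ₀ := lt_min hR₀ hδ₀
    obtain ⟨r, L, hr, hφ⟩ := exists_continuous_isHolderBump hβ hd.nonneg hequiv hR
    obtain ⟨C, hC, hCle⟩ := hdoub.exists_measure_qball_le_mul hd₁ hR (min_le_right _ _) hr
    exact ⟨r, _, L, C, hr, hR, min_le_left _ _, hC, hCle, fun x =>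
      (hφ x).imp fun φ h => ⟨h.1.measurable, h.2⟩⟩

end Bumps

section EllNorm

variable {q : ℝ≥0∞}

theorem ellNorm_const_mul (hq : q ≠ 0) (c : ℝ≥0∞) (a : ℤ → ℝ≥0∞) :
    ellNorm q (fun k => c * a k) = c * ellNorm q a := by
  unfold ellNorm
  split_ifs with hq'
  · rw [ENNReal.mul_iSup]
  · have hQ : 0 < q.toReal := ENNReal.toReal_pos hq hq'
    simp only [ENNReal.mul_rpow_of_nonneg _ _ hQ.le]
    rw [ENNReal.tsum_mul_left, ENNReal.mul_rpow_of_nonneg _ _ (by positivity),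
      ← ENNReal.rpow_mul, mul_one_div_cancel hQ.ne', ENNReal.rpow_one]

theorem summable_rpow_neg_mul_abs {b θ : ℝ} (hb : 1 < b) (hθ : 0 < θ) :
    Summable fun k : ℤ => b ^ (-θ * |(k : ℝ)|) := by
  have hb₀ : 0 < b := one_pos.trans hb
  have hgeo : Summable fun n : ℕ => (b ^ (-θ)) ^ n :=
    summable_geometric_of_lt_one (by positivity)
      (Real.rpow_lt_one_of_one_lt_of_neg hb (neg_neg_of_pos hθ))
  simp only [← Real.rpow_mul_natCast hb₀.le] at hgeo
  exact Summable.of_nat_of_neg (by simpa using hgeo) (by simpa using hgeo)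

theorem ellNorm_rpow_neg_mul_abs_lt_top (hq : q ≠ 0) {b θ : ℝ} (hb : 1 < b) (hθ : 0 ≤ θ)
    (h : q = ∞ ∨ 0 < θ) : ellNorm q (fun k => ENNReal.ofReal (b ^ (-θ * |(k : ℝ)|))) < ∞ := by
  have hb₀ : 0 < b := one_pos.trans hb
  unfold ellNorm
  split_ifs with hq'
  · have hle : ∀ k : ℤ, b ^ (-θ * |(k : ℝ)|) ≤ 1 := fun k =>
      Real.rpow_le_one_of_one_le_of_nonpos hb.le
        (mul_nonpos_of_nonpos_of_nonneg (neg_nonpos.2 hθ) (abs_nonneg _))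
    exact (iSup_le fun k => ENNReal.ofReal_le_one.2 (hle k)).trans_lt ENNReal.one_lt_top
  · have hQ : 0 < q.toReal := ENNReal.toReal_pos hq hq'
    have hterm : ∀ k : ℤ, ENNReal.ofReal (b ^ (-θ * |(k : ℝ)|)) ^ q.toReal =
        ENNReal.ofReal (b ^ (-(θ * q.toReal) * |(k : ℝ)|)) := fun k => by
      rw [ENNReal.ofReal_rpow_of_nonneg (by positivity) hQ.le, ← Real.rpow_mul hb₀.le]
      ring_nf
    simp only [hterm]
    exact ENNReal.rpow_lt_top_of_nonneg (by positivity)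
      (summable_rpow_neg_mul_abs hb (mul_pos (h.resolve_left hq') hQ)).tsum_ofReal_ne_top

end EllNorm

section SeparableGradients

variable {X : Type*} [MeasurableSpace X] {d : X → X → ℝ} {μ : Measure X} {α β L : ℝ} {p q : ℝ≥0∞}
  {u φ : X → ℝ} {A B : Set X} {a : ℤ → ℝ≥0∞} {b : ℝ≥0∞}

theorem IsFracGradient.homSeminormM_le (hp₀ : p ≠ 0) (hp : p ≠ ∞) (hq : q ≠ 0)
    (hB : MeasurableSet B) (h : IsFracGradient d μ α u fun k => B.indicator fun _ => b * a k) :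
    homSeminormM d μ α p q u ≤ ellNorm q a * (b * μ B ^ (1 / p.toReal)) := by
  have hell : (fun x => ellNorm q fun k => B.indicator (fun _ => b * a k) x) =
      B.indicator fun _ => b * ellNorm q a := by
    ext x
    by_cases hx : x ∈ B
    · simpa [hx] using ellNorm_const_mul hq b a
    · simpa [hx] using ellNorm_const_mul hq 0 a
  refine (iInf₂_le _ h).trans_eq ?_
  rw [hell, eLpNorm_indicator_const hB hp₀ hp, enorm_eq_self, mul_comm b, mul_assoc]

theorem IsFracGradient.homSeminormN_le (hp₀ : p ≠ 0) (hp : p ≠ ∞) (hq : q ≠ 0)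
    (hB : MeasurableSet B) (h : IsFracGradient d μ α u fun k => B.indicator fun _ => b * a k) :
    homSeminormN d μ α p q u ≤ ellNorm q a * (b * μ B ^ (1 / p.toReal)) := by
  refine (iInf₂_le _ h).trans_eq ?_
  simp only [eLpNorm_indicator_const hB hp₀ hp, enorm_eq_self]
  rw [mul_comm (ellNorm q a), ← ellNorm_const_mul hq]
  simp only [mul_right_comm]

theorem IsFracGradient.const_mul (c : ℝ) {g : ℤ → X → ℝ≥0∞} (h : IsFracGradient d μ α u g) :
    IsFracGradient d μ α (fun x => c * u x) fun k x => ‖c‖ₑ * g k x := by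
  obtain ⟨hg, E, hE, hμE, h⟩ := h
  refine ⟨fun k => (hg k).const_mul _, E, hE, hμE, fun k x y hx hy hk hk' => ?_⟩
  rw [← mul_sub, abs_mul, ENNReal.ofReal_mul (abs_nonneg c), ← Real.enorm_eq_ofReal_abs c,
    ← mul_add, mul_left_comm]
  exact mul_le_mul_right (h k x y hx hy hk hk') _

/-- At scales above `1` use the bound `t ≤ 1`, at scales below `1` the Hölder bound. -/
theorem le_rpow_mul_rpow_neg_mul_abs {t δ : ℝ} (hα : 0 ≤ α) (hαβ : α ≤ β) (ht : t ≤ 1)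
    (htL : t ≤ L * δ ^ β) {k : ℤ} (hk : (2 : ℝ) ^ (-k - 1) ≤ δ) (hk' : δ < (2 : ℝ) ^ (-k)) :
    t ≤ δ ^ α * (max (2 ^ α) L * (2 : ℝ) ^ (-min α (β - α) * |(k : ℝ)|)) := by
  have hδ : 0 < δ := lt_of_lt_of_le (by positivity) hk
  have : 0 ≤ β - α := sub_nonneg.2 hαβ
  replace hk : (2 : ℝ) ^ (-(k : ℝ) - 1) ≤ δ := by exact_mod_cast hk
  replace hk' : δ ≤ (2 : ℝ) ^ (-(k : ℝ)) := by exact_mod_cast hk'.le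
  rcases le_total (k : ℝ) 0 with hk₀ | hk₀
  · calc t ≤ ((2 : ℝ) ^ (-(k : ℝ) - 1)) ^ α * (2 ^ α * (2 : ℝ) ^ (-α * |(k : ℝ)|)) := by
          rw [← Real.rpow_mul two_pos.le, ← Real.rpow_add two_pos, ← Real.rpow_add two_pos,
            abs_of_nonpos hk₀]
          ring_nf
          simpa using ht
      _ ≤ _ := by
          gcongr
          · exact le_max_left _ _
          · exact one_le_two
          · exact min_le_left _ _
  · calc t ≤ L * δ ^ β := htL
      _ ≤ max (2 ^ α) L * (δ ^ α * ((2 : ℝ) ^ (-(k : ℝ))) ^ (β - α)) := by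
          rw [← add_sub_cancel α β, Real.rpow_add hδ, add_sub_cancel]
          gcongr
          exact le_max_right _ _
      _ = δ ^ α * (max (2 ^ α) L * (2 : ℝ) ^ (-(β - α) * |(k : ℝ)|)) := by
          rw [← Real.rpow_mul two_pos.le, abs_of_nonneg hk₀]
          ring_nf
      _ ≤ _ := by
          gcongr
          · exact one_le_two
          · exact min_le_right _ _

/-- The factors `a k` in the `α`-fractional gradient `k ↦ a k • 1_B` of a `β`-Hölder bump function
with Hölder constant `L`. -/
noncomputable def bumpWeight (α β L : ℝ) (k : ℤ) : ℝ≥0∞ :=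
  ENNReal.ofReal (max (2 ^ α) L) * ENNReal.ofReal ((2 : ℝ) ^ (-min α (β - α) * |(k : ℝ)|))

theorem ellNorm_bumpWeight_ne_top (hα : 0 < α) (hαβ : α ≤ β) (L : ℝ) (hq : q ≠ 0)
    (h : q = ∞ ∨ α < β) : ellNorm q (bumpWeight α β L) ≠ ∞ := by
  unfold bumpWeight
  rw [ellNorm_const_mul hq]
  exact ENNReal.mul_ne_top ENNReal.ofReal_ne_top (ellNorm_rpow_neg_mul_abs_lt_top hq one_lt_two
    (le_min hα.le (sub_nonneg.2 hαβ)) (h.imp_right fun h => lt_min hα (sub_pos.2 h))).ne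

namespace IsHolderBump

theorem isFracGradient (h : IsHolderBump d β L A B φ) (hd : ∀ x y, 0 ≤ d x y)
    (hB : MeasurableSet B) (hα : 0 ≤ α) (hαβ : α ≤ β) :
    IsFracGradient d μ α φ fun k => B.indicator fun _ => bumpWeight α β L k := by
  refine ⟨fun k => measurable_const.indicator hB, ∅, MeasurableSet.empty, measure_empty,
    fun k x y _ _ hk hk' => ?_⟩
  have hle := ENNReal.ofReal_le_ofReal (le_rpow_mul_rpow_neg_mul_abs hα hαβ
    (h.abs_sub_le_one x y) (h.abs_sub_le x y) hk hk')
  rw [ENNReal.ofReal_mul (Real.rpow_nonneg (hd x y) α),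
    ENNReal.ofReal_mul (le_max_of_le_left (by positivity)), ← bumpWeight] at hle
  by_cases hx : x ∈ B
  · refine hle.trans (mul_le_mul_right ?_ _)
    simp only [Set.indicator_of_mem hx, le_self_add]
  by_cases hy : y ∈ B
  · refine hle.trans (mul_le_mul_right ?_ _)
    simp only [Set.indicator_of_mem hy, le_add_self]
  · simp [h.eq_zero x hx, h.eq_zero y hy]

theorem isFracGradient_const_mul (h : IsHolderBump d β L A B φ) (hd : ∀ x y, 0 ≤ d x y)
    (hB : MeasurableSet B) (hα : 0 ≤ α) (hαβ : α ≤ β) (c : ℝ) :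
    IsFracGradient d μ α (fun x => c * φ x) fun k =>
      B.indicator fun _ => ‖c‖ₑ * bumpWeight α β L k := by
  simpa only [← Set.indicator_const_mul] using (h.isFracGradient hd hB hα hαβ).const_mul c

theorem eLpNorm_const_mul_le (h : IsHolderBump d β L A B φ) (c : ℝ) :
    eLpNorm (fun x => c * φ x) p μ ≤ ‖c‖ₑ * μ B ^ (1 / p.toReal) := by
  refine (eLpNorm_mono fun x => ?_).trans (eLpNorm_indicator_const_le c p)
  by_cases hx : x ∈ B
  · rw [Set.indicator_of_mem hx, norm_mul]
    exact mul_le_of_le_one_right (norm_nonneg c)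
      (by rw [Real.norm_of_nonneg (h.mem_Icc x).1]; exact (h.mem_Icc x).2)
  · simp [hx, h.eq_zero x hx]

theorem enorm_mul_le_eLpNorm_sub (h : IsHolderBump d β L A B φ) (hp₀ : p ≠ 0) (hp : p ≠ ∞)
    (hA : MeasurableSet A) (hAB : A ⊆ B) {v : X → ℝ} (hv : ∀ x ∈ B, v x = 0) (c : ℝ) :
    ‖c‖ₑ * μ A ^ (1 / p.toReal) ≤ eLpNorm ((fun x => c * φ x) - v) p μ := by
  rw [← eLpNorm_indicator_const hA hp₀ hp]
  refine eLpNorm_mono fun x => ?_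
  by_cases hx : x ∈ A
  · simp [hx, h.eq_one x hx, hv x (hAB hx)]
  · simp [hx]

end IsHolderBump

end SeparableGradients

section Converse

variable {X : Type*} [MeasurableSpace X] {d : X → X → ℝ} {μ : Measure X} {α : ℝ} {p q : ℝ≥0∞}

theorem EmbedsCompactly.exists_eLpNorm_sub_lt {S : Set (X → ℝ)} {N : (X → ℝ) → ℝ≥0∞}
    (h : EmbedsCompactly S N p μ) {u : ℕ → X → ℝ} (hu : ∀ n, u n ∈ S) {C : ℝ≥0∞} (hC : C ≠ ∞)
    (huC : ∀ n, N (u n) ≤ C) {ε : ℝ≥0∞} (hε : ε ≠ 0) :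
    ∃ m n, m ≠ n ∧ eLpNorm (u m - u n) p μ < ε := by
  obtain ⟨f, φ, hf, hφ, hlim⟩ := h.2 u hu ⟨C, hC.lt_top, huC⟩
  obtain ⟨η, hη, hclose⟩ := exists_eLpNorm_sub_lt_of_close (E := ℝ) p μ hε
  have hev := hlim.eventually (Iic_mem_nhds hη)
  obtain ⟨n, hn, hn'⟩ := (hev.and ((tendsto_add_atTop_nat 1).eventually hev)).exists
  exact ⟨φ n, φ (n + 1), (hφ n.lt_succ_self).ne, hclose _ _ f (h.1 _ (hu _)).1 (h.1 _ (hu _)).1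
    hf.1 hn hn'⟩

theorem exists_enorm_mul_measure_rpow_eq_one (p : ℝ≥0∞) {A B : Set X} {C : ℝ≥0∞} (hA₀ : μ A ≠ 0)
    (hA : μ A ≠ ∞) (hBA : μ B ≤ C * μ A) :
    ∃ c : ℝ, ‖c‖ₑ * μ A ^ (1 / p.toReal) = 1 ∧
      ‖c‖ₑ * μ B ^ (1 / p.toReal) ≤ C ^ (1 / p.toReal) := by
  have hs : 0 ≤ 1 / p.toReal := by positivity
  have ht₀ : μ A ^ (1 / p.toReal) ≠ 0 := (ENNReal.rpow_pos (pos_iff_ne_zero.2 hA₀) hA).ne'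
  have ht : μ A ^ (1 / p.toReal) ≠ ∞ := ENNReal.rpow_ne_top_of_nonneg hs hA
  have hc : ‖((μ A ^ (1 / p.toReal))⁻¹).toReal‖ₑ = (μ A ^ (1 / p.toReal))⁻¹ := by
    rw [Real.enorm_of_nonneg ENNReal.toReal_nonneg,
      ENNReal.ofReal_toReal (ENNReal.inv_ne_top.2 ht₀)]
  refine ⟨_, by rw [hc, ENNReal.inv_mul_cancel ht₀ ht], ?_⟩
  calc _ ≤ (μ A ^ (1 / p.toReal))⁻¹ * (C * μ A) ^ (1 / p.toReal) := by rw [hc]; gcongr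
    _ = C ^ (1 / p.toReal) := by
        rw [ENNReal.mul_rpow_of_nonneg _ _ hs, mul_left_comm, ENNReal.inv_mul_cancel ht₀ ht,
          mul_one]

namespace IsQuasiMetricMeasureSpace

variable [Nontrivial X]

theorem exists_separated_bounded_seq_of_not_isTotallyBounded (hX : IsQuasiMetricMeasureSpace d μ)
    {δ₀ : ℝ} (hδ₀ : 0 < δ₀) (hdoub : IsDoublingUpTo d μ (optConst d) δ₀) (hα : 0 < α) (hp₀ : p ≠ 0)
    (hp : p ≠ ∞) (hq : q ≠ 0) (hadm : Admissible d α q) (h : ¬ IsTotallyBounded d) :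
    ∃ (u : ℕ → X → ℝ) (K M : ℝ≥0∞), K ≠ ∞ ∧ M ≠ ∞ ∧
      (∀ n, Measurable (u n) ∧ eLpNorm (u n) p μ ≤ K ∧ homSeminormM d μ α p q (u n) ≤ M ∧
        homSeminormN d μ α p q (u n) ≤ M) ∧
      ∀ m n, m ≠ n → 1 ≤ eLpNorm (u m - u n) p μ := by
  have hd := hX.isQuasiMetric
  obtain ⟨x, R₀, hR₀, hdisj⟩ := hd.exists_seq_pairwise_disjoint_qball h
  obtain ⟨ρ, β, hρ, hdρ, hρβ, hαβ, hqβ⟩ := hadm.exists_exponent hα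
  obtain ⟨r, R, L, C, hr, hR, hRR₀, hC, hCle, hbump⟩ :=
    hX.exists_isHolderBump hδ₀ hdoub hρ hdρ (hα.trans_le hαβ) hρβ hR₀
  choose φ hφmeas hφ using fun n => hbump (x n)
  have hBmeas n := hX.measurableSet_qball (x n) R hR
  choose c hcA hcB using fun n => exists_enorm_mul_measure_rpow_eq_one p
    (hX.measure_qball_pos (x n) r hr).ne' (hX.measure_qball_lt_top (x n) r hr).ne (hCle (x n))
  have hgrad n := (hφ n).isFracGradient_const_mul (μ := μ) hd.nonneg (hBmeas n) hα.le hαβ (c n)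
  have hK : C ^ (1 / p.toReal) ≠ ∞ := ENNReal.rpow_ne_top_of_nonneg (by positivity) hC
  refine ⟨fun n y => c n * φ n y, C ^ (1 / p.toReal),
    ellNorm q (bumpWeight α β L) * C ^ (1 / p.toReal), hK,
    ENNReal.mul_ne_top (ellNorm_bumpWeight_ne_top hα hαβ L hq hqβ) hK,
    fun n => ⟨(hφmeas n).const_mul _, ((hφ n).eLpNorm_const_mul_le (c n)).trans (hcB n),
      ((hgrad n).homSeminormM_le hp₀ hp hq (hBmeas n)).trans (mul_le_mul_right (hcB n) _),
      ((hgrad n).homSeminormN_le hp₀ hp hq (hBmeas n)).trans (mul_le_mul_right (hcB n) _)⟩,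
    fun m n hmn => ?_⟩
  have hAB : qball d (x m) r ⊆ qball d (x m) R := fun y hy => by
    by_contra hyR
    exact zero_ne_one (((hφ m).eq_zero y hyR).symm.trans ((hφ m).eq_one y hy))
  have hzero : ∀ y ∈ qball d (x m) R, c n * φ n y = 0 := fun y hy => by
    rw [(hφ n).eq_zero y fun hy' => Set.disjoint_left.1 (hdisj hmn) (qball_mono _ hRR₀ hy)
      (qball_mono _ hRR₀ hy'), mul_zero]
  exact (hcA m).ge.trans ((hφ m).enorm_mul_le_eLpNorm_sub hp₀ hp
    (hX.measurableSet_qball (x m) r hr) hAB hzero (c m))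

theorem isTotallyBounded_of_compactEmbM (hX : IsQuasiMetricMeasureSpace d μ)
    {δ₀ : ℝ} (hδ₀ : 0 < δ₀) (hdoub : IsDoublingUpTo d μ (optConst d) δ₀) (hα : 0 < α) (hp₀ : p ≠ 0)
    (hp : p ≠ ∞) (hq : q ≠ 0) (hadm : Admissible d α q) (h : CompactEmbM d μ α p q) :
    IsTotallyBounded d := by
  by_contra hnot
  obtain ⟨u, K, M, hK, hM, hu, hsep⟩ :=
    hX.exists_separated_bounded_seq_of_not_isTotallyBounded hδ₀ hdoub hα hp₀ hp hq hadm hnot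
  obtain ⟨m, n, hmn, hlt⟩ := h.exists_eLpNorm_sub_lt
    (fun n => ⟨(hu n).1, ⟨(hu n).1.aestronglyMeasurable, (hu n).2.1.trans_lt hK.lt_top⟩,
      (hu n).2.2.1.trans_lt hM.lt_top⟩)
    (ENNReal.add_ne_top.2 ⟨hK, hM⟩) (fun n => add_le_add (hu n).2.1 (hu n).2.2.1) one_ne_zero
  exact hlt.not_ge (hsep m n hmn)

theorem isTotallyBounded_of_compactEmbN (hX : IsQuasiMetricMeasureSpace d μ)
    {δ₀ : ℝ} (hδ₀ : 0 < δ₀) (hdoub : IsDoublingUpTo d μ (optConst d) δ₀) (hα : 0 < α) (hp₀ : p ≠ 0)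
    (hp : p ≠ ∞) (hq : q ≠ 0) (hadm : Admissible d α q) (h : CompactEmbN d μ α p q) :
    IsTotallyBounded d := by
  by_contra hnot
  obtain ⟨u, K, M, hK, hM, hu, hsep⟩ :=
    hX.exists_separated_bounded_seq_of_not_isTotallyBounded hδ₀ hdoub hα hp₀ hp hq hadm hnot
  obtain ⟨m, n, hmn, hlt⟩ := h.exists_eLpNorm_sub_lt
    (fun n => ⟨(hu n).1, ⟨(hu n).1.aestronglyMeasurable, (hu n).2.1.trans_lt hK.lt_top⟩,
      (hu n).2.2.2.trans_lt hM.lt_top⟩)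
    (ENNReal.add_ne_top.2 ⟨hK, hM⟩) (fun n => add_le_add (hu n).2.1 (hu n).2.2.2) one_ne_zero
  exact hlt.not_ge (hsep m n hmn)

end IsQuasiMetricMeasureSpace

end Converse

end QuasiMetric

theorem mainTheorem1 {X : Type*} [Nontrivial X] [MeasurableSpace X]
    (d : X → X → ℝ) (μ : Measure X)
    (hX : QuasiMetric.IsQuasiMetricMeasureSpace d μ)
    (hdoub : ∃ δ₀ : ℝ, 0 < δ₀ ∧ ∀ δ : ℝ, 0 < δ → δ ≤ δ₀ →
      QuasiMetric.IsDoublingAt d μ (QuasiMetric.optConst d) δ) :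
    List.TFAE [
      QuasiMetric.IsTotallyBounded d,
      QuasiMetric.IsIntegrableMeasure d μ,
      ∀ (α : ℝ) (p q : ℝ≥0∞), 0 < α → 0 < p → p < ∞ → 0 < q →
        QuasiMetric.Admissible d α q → QuasiMetric.CompactEmbM d μ α p q,
      ∀ (α : ℝ) (p q : ℝ≥0∞), 0 < α → 0 < p → p < ∞ → 0 < q →
        QuasiMetric.Admissible d α q → QuasiMetric.CompactEmbN d μ α p q,
      ∃ (α : ℝ) (p q : ℝ≥0∞), 0 < α ∧ 0 < p ∧ p < ∞ ∧ 0 < q ∧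
        QuasiMetric.Admissible d α q ∧ QuasiMetric.CompactEmbM d μ α p q,
      ∃ (α : ℝ) (p q : ℝ≥0∞), 0 < α ∧ 0 < p ∧ p < ∞ ∧ 0 < q ∧
        QuasiMetric.Admissible d α q ∧ QuasiMetric.CompactEmbN d μ α p q] := by
  obtain ⟨δ₀, hδ₀, hdoub⟩ := hdoub
  obtain ⟨α₀, hα₀, hadm₀⟩ := hX.isQuasiMetric.exists_admissible 1
  tfae_have 1 → 2 := hX.isIntegrableMeasure_of_isTotallyBounded
  tfae_have 2 → 1 := hX.isTotallyBounded_of_isIntegrableMeasure hδ₀ hdoub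
  tfae_have 1 → 3 := fun h _ _ _ hα hp hp' hq _ =>
    hX.compactEmbM_of_isTotallyBounded h hα hp.ne' hp'.ne hq.ne'
  tfae_have 1 → 4 := fun h _ _ _ hα hp hp' hq _ =>
    hX.compactEmbN_of_isTotallyBounded h hα hp.ne' hp'.ne hq.ne'
  tfae_have 3 → 5 := fun h => ⟨α₀, 1, 1, hα₀, one_pos, ENNReal.one_lt_top, one_pos, hadm₀,
    h α₀ 1 1 hα₀ one_pos ENNReal.one_lt_top one_pos hadm₀⟩
  tfae_have 4 → 6 := fun h => ⟨α₀, 1, 1, hα₀, one_pos, ENNReal.one_lt_top, one_pos, hadm₀,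
    h α₀ 1 1 hα₀ one_pos ENNReal.one_lt_top one_pos hadm₀⟩
  tfae_have 5 → 1 := fun ⟨_, _, _, hα, hp, hp', hq, hadm, h⟩ =>
    hX.isTotallyBounded_of_compactEmbM hδ₀ hdoub hα hp.ne' hp'.ne hq.ne' hadm h
  tfae_have 6 → 1 := fun ⟨_, _, _, hα, hp, hp', hq, hadm, h⟩ =>
    hX.isTotallyBounded_of_compactEmbN hδ₀ hdoub hα hp.ne' hp'.ne hq.ne' hadm h
  tfae_finish
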